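/- Let $\mathrm{Conf}_n(\mathbb{CP}^1)$ be the space of configurations of $n$ distinct unordered points of $\mathbb{CP}^1$, and let $\mathrm{Conf}_{n,m}(\mathbb{CP}^1)$ be the space of configurations of $n+m$ distinct points of $\mathbb{CP}^1$ divided into $n$ unordered old points and $m$ unordered new points (the quotients of the space of ordered configurations by $S_n$ and by $S_n\times S_m$, respectively). A section of the bundle $\mathrm{Conf}_{n,m}(\mathbb{CP}^1)\to\mathrm{Conf}_n(\mathbb{CP}^1)$, which forgets the new points, is a continuous right inverse of this map. (1) For every integer $m\ge 0$ with $m\equiv 0$ or $2 \pmod 3$ there is a section $S$ of $\mathrm{Conf}_{3,m}(\mathbb{CP}^1)\to\mathrm{Conf}_3(\mathbb{CP}^1)$ which is algebraic (a morphism of quasi-projective varieties) and equivariant under $\mathrm{PGL}_2(\mathbb{C})$. Moreover there is a finite set $\Lambda\subset\mathbb{C}\setminus\{0,1\}$ such that, for every $\{z_1,z_2,z_3\}\in\mathrm{Conf}_3(\mathbb{CP}^1)$, the set of new points of $S(\{z_1,z_2,z_3\})$ is the set of all $p\in\mathbb{CP}^1$ for which the four points $z_1,z_2,z_3,p$ are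 distinct and have, in some order, a cross-ratio in $\Lambda$; here $[w_1,w_2;w_3,w_4]$ is the image of $w_4$ under the Möbius transformation taking $(w_1,w_2,w_3)$ to $(0,1,\infty)$. (2) For every integer $m\ge 70$ with $m\equiv 0,6,16$ or $22\pmod{24}$ there is a (continuous) section of $\mathrm{Conf}_{4,m}(\mathbb{CP}^1)\to\mathrm{Conf}_4(\mathbb{CP}^1)$. -/

import Mathlib

open scoped MatrixGroups Polynomial

noncomputable section

namespace SphereConf

/-- The complex projective line (Riemann sphere), as the one-point compactification of `ℂ`.
`GL (Fin 2) ℂ` acts on it by Möbius transformations, through the quotient `PGL₂(ℂ)`. -/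
abbrev CP1 : Type := OnePoint ℂ

/-- Ordered configurations: families of distinct points of `X` indexed by `ι`, with the
topology of a subspace of `ι → X`. -/
abbrev PConf (ι X : Type) : Type := {z : ι → X // Function.Injective z}

/-- Two ordered configurations of `n` points are identified if they differ by an element of
the symmetric group. -/
def confSetoid (n : ℕ) (X : Type) : Setoid (PConf (Fin n) X) where
  r z w := ∃ σ : Equiv.Perm (Fin n), w.1 = z.1 ∘ σ
  iseqv :=
    { refl := fun _ => ⟨1, rfl⟩
      symm := by
        rintro z w ⟨σ, h⟩
        exact ⟨σ.symm, by rw [h]; funext i; simp⟩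
      trans := by
        rintro z w u ⟨σ, h⟩ ⟨τ, k⟩
        exact ⟨τ.trans σ, by rw [k, h]; rfl⟩ }

/-- `Conf n X`: the space of configurations of `n` distinct unordered points of `X`, with the
quotient topology. -/
abbrev Conf (n : ℕ) (X : Type) : Type := Quotient (confSetoid n X)

/-- Two ordered configurations of `n + m` points are identified if they differ by an element
of the product of the two symmetric groups. -/
def biConfSetoid (n m : ℕ) (X : Type) : Setoid (PConf (Fin n ⊕ Fin m) X) where
  r z w := ∃ (σ : Equiv.Perm (Fin n)) (τ : Equiv.Perm (Fin m)), w.1 = z.1 ∘ Sum.map σ τ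
  iseqv :=
    { refl := fun z => ⟨1, 1, by funext i; cases i <;> rfl⟩
      symm := by
        rintro z w ⟨σ, τ, h⟩
        exact ⟨σ.symm, τ.symm, by rw [h]; funext i; cases i <;> simp⟩
      trans := by
        rintro z w u ⟨σ, τ, h⟩ ⟨σ', τ', k⟩
        exact ⟨σ'.trans σ, τ'.trans τ, by rw [k, h]; funext i; cases i <;> rfl⟩ }

/-- `BiConf n m X`: the space `Conf_{n,m}(X)` of configurations of `n + m` distinct points of
`X`, divided into `n` old points and `m` new points, with the quotient topology. -/
abbrev BiConf (n m : ℕ) (X : Type) : Type := Quotient (biConfSetoid n m X)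

/-- The bundle projection `Conf_{n,m}(X) → Conf_n(X)`, which keeps the old points. -/
def oldPoints {n m : ℕ} {X : Type} : BiConf n m X → Conf n X :=
  Quotient.map' (s₁ := biConfSetoid n m X) (s₂ := confSetoid n X)
    (fun z => ⟨z.1 ∘ Sum.inl, z.2.comp Sum.inl_injective⟩) (by
      rintro z w ⟨σ, τ, h⟩
      exact ⟨σ, by funext i; simp [h]⟩)

/-- The map `Conf_{n,m}(X) → Conf_m(X)` which keeps the new points. -/
def newPoints {n m : ℕ} {X : Type} : BiConf n m X → Conf m X :=
  Quotient.map' (s₁ := biConfSetoid n m X) (s₂ := confSetoid m X)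
    (fun z => ⟨z.1 ∘ Sum.inr, z.2.comp Sum.inr_injective⟩) (by
      rintro z w ⟨σ, τ, h⟩
      exact ⟨τ, by funext i; simp [h]⟩)

/-- The underlying set of points of an unordered configuration. -/
def Conf.points {n : ℕ} {X : Type} (c : Conf n X) : Set X :=
  Quotient.lift (s := confSetoid n X) (fun z => Set.range z.1) (by
    rintro z w ⟨σ, h⟩
    simp only [h]
    exact (σ.surjective.range_comp z.1).symm) c

/-- A group acting on `X` acts pointwise on configurations. -/
instance instSMulConf {G X : Type} [Group G] [MulAction G X] (n : ℕ) : SMul G (Conf n X) where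
  smul g := Quotient.map' (s₁ := confSetoid n X) (s₂ := confSetoid n X)
    (fun z => ⟨fun i => g • z.1 i, (MulAction.injective g).comp z.2⟩) (by
      rintro z w ⟨σ, h⟩
      exact ⟨σ, by funext i; simp [h]⟩)

/-- A group acting on `X` acts pointwise on bicoloured configurations. -/
instance instSMulBiConf {G X : Type} [Group G] [MulAction G X] (n m : ℕ) :
    SMul G (BiConf n m X) where
  smul g := Quotient.map' (s₁ := biConfSetoid n m X) (s₂ := biConfSetoid n m X)
    (fun z => ⟨fun i => g • z.1 i, (MulAction.injective g).comp z.2⟩) (by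
      rintro z w ⟨σ, τ, h⟩
      exact ⟨σ, τ, by funext i; simp [h]⟩)

/-- A (continuous) section of the bundle `Conf_{n,m}(X) → Conf_n(X)`. -/
def IsSection {n m : ℕ} {X : Type} [TopologicalSpace X]
    (S : Conf n X → BiConf n m X) : Prop :=
  Continuous S ∧ ∀ c, oldPoints (S c) = c

/-- The linear form vanishing at a point of the projective line, dehomogenized by `Y = 1`:
`X - aY` for `a ∈ ℂ`, and `Y` for `∞`. -/
def pointForm (p : CP1) : ℂ[X] :=
  p.elim 1 (fun a => Polynomial.X - Polynomial.C a)

/-- Homogeneous coordinates of an unordered configuration of `n` points in `ℙⁿ`: the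
coefficients (of `X ^ j * Y ^ (n - j)`, for `0 ≤ j ≤ n`) of the binary form of degree `n` whose
zeros are the points. This realizes `Conf_n(ℂℙ¹)` as the quasi-projective variety of binary forms
of degree `n` with nonzero discriminant, up to scalars. -/
def Conf.coords {n : ℕ} (c : Conf n CP1) : Fin (n + 1) → ℂ :=
  Quotient.lift (s := confSetoid n CP1)
    (fun z => fun j : Fin (n + 1) => (∏ i, pointForm (z.1 i)).coeff j) (by
      rintro z w ⟨σ, h⟩
      funext j
      simp only [h, Function.comp_apply]
      rw [Equiv.prod_comp σ (fun i => pointForm (z.1 i))]) c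

/-- Morphisms of quasi-projective varieties `Conf_n(ℂℙ¹) → Conf_m(ℂℙ¹)`: near every point (for
the Zariski topology) the map is given, in homogeneous coordinates, by homogeneous polynomials of
one and the same degree without a common zero. -/
def IsRegularMap {n m : ℕ} (f : Conf n CP1 → Conf m CP1) : Prop :=
  ∀ c₀ : Conf n CP1, ∃ (d : ℕ) (F : Fin (m + 1) → MvPolynomial (Fin (n + 1)) ℂ),
    (∀ j, (F j).IsHomogeneous d) ∧
    (∃ j, MvPolynomial.eval c₀.coords (F j) ≠ 0) ∧
    ∀ c : Conf n CP1, (∃ j, MvPolynomial.eval c.coords (F j) ≠ 0) →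
      ∃ u : ℂ, u ≠ 0 ∧ ∀ j, MvPolynomial.eval c.coords (F j) = u * (f c).coords j

/-- Morphisms of varieties into `Conf_{k,m}(ℂℙ¹)`, which is an open subvariety of
`Conf_k(ℂℙ¹) × Conf_m(ℂℙ¹)`: both components are morphisms. -/
def IsAlgebraicMap {n k m : ℕ} (S : Conf n CP1 → BiConf k m CP1) : Prop :=
  IsRegularMap (fun c => oldPoints (S c)) ∧ IsRegularMap (fun c => newPoints (S c))

/-- `[z₀, z₁; z₂, z₃] = l`: the Möbius transformation which takes `(z₀, z₁, z₂)` to `(0, 1, ∞)`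
takes `z₃` to `l`. -/
def HasCrossRatio (z : PConf (Fin 4) CP1) (l : ℂ) : Prop :=
  ∃ g : GL (Fin 2) ℂ, g • z.1 0 = ((0 : ℂ) : CP1) ∧ g • z.1 1 = ((1 : ℂ) : CP1) ∧
    g • z.1 2 = OnePoint.infty ∧ g • z.1 3 = (l : CP1)

/-- The set of the points `p` which, together with the three points of the configuration `c`,
have cross-ratio `l` in some order. -/
def crossRatioOrbit (c : Conf 3 CP1) (l : ℂ) : Set CP1 :=
  {p | ∃ z : PConf (Fin 4) CP1, Set.range z.1 = insert p c.points ∧ HasCrossRatio z l}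

end SphereConf

end

/-! A section is obtained by attaching to the linear forms of the n old points a binary form of
degree m with simple zeros, none at an old point. If this form varies continuously and changes only
by a nonzero scalar when the old linear forms are rescaled or permuted, its zeros depend only on the
configuration and move continuously. This is `IsFormFamily` and `IsFormFamily.exists_section`.

Three points. Möbius transformations act simply transitively on ordered triples, so a new point is a
cross-ratio in ℂ \ {0, 1}, and a finite set of cross-ratios stable under the anharmonic group S₃
gives an equivariant choice. The orbits of S₃ have 2 elements (the roots of λ² - λ + 1), 3 elements
(-1, 1/2, 2), or 6. Using each exceptional orbit at most once gives m ≡ 0, 2, 3, 5 mod 6. The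
corresponding forms are products of combinations of the Hessian and the cubic covariant of the
binary cubic, which makes the section algebraic.

Four points. Let f be the quartic, H its normalized Hessian and x = H/f. This map of degree 4 is the
quotient by the Klein four-group of Möbius transformations preserving the configuration. The old
points lie over x = ∞, and the branch values are the roots e₁, e₂, e₃ of the resolvent cubic x³ + Ax
+ B, because H - eᵢf = qᵢ². New points are taken over finite sets of x-values: the branch values
give 6 points (`sextic`), the four roots of the 3-division polynomial give 16 (`threeTorsion`), and
the six values of a fixed modulus whose sixth power has the phase of the discriminant give 24
(`circle`). The last choice is continuous but not algebraic. It can be repeated on arbitrarily many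
circles, all lying outside the other values, so m = 6δ + 16ε + 24s with δ, ε ≤ 1. -/

noncomputable section

/-! ### Binary forms with simple zeros -/

namespace SphereConf

open Polynomial

/-- Homogeneous coordinates of a point of the projective line. -/
def rep (p : CP1) : ℂ × ℂ := p.elim (1, 0) (fun a => (-a, -1))

/-- The determinant pairing on `ℂ²`. -/
def br (a v : ℂ × ℂ) : ℂ := a.1 * v.2 - a.2 * v.1

/-- `a` represents the point `p` of the projective line. -/
def IsLift (p : CP1) (a : ℂ × ℂ) : Prop := ∃ c : ℂ, c ≠ 0 ∧ a = c • rep p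

/-- `G` is, up to a nonzero scalar, the product of the linear forms vanishing at the points
of `Z`. -/
def HasZeros (G : ℂ × ℂ → ℂ) (Z : Finset CP1) : Prop :=
  ∃ u : ℂ, u ≠ 0 ∧ ∀ v, G v = u * ∏ p ∈ Z, br (rep p) v

/-- `G` is a product of `m` pairwise independent linear forms. -/
def SimpleZeros (m : ℕ) (G : ℂ × ℂ → ℂ) : Prop := ∃ Z : Finset CP1, Z.card = m ∧ HasZeros G Z

@[simp] lemma rep_infty : rep OnePoint.infty = (1, 0) := rfl
@[simp] lemma rep_coe (a : ℂ) : rep (a : CP1) = (-a, -1) := rfl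

lemma rep_ne_zero (p : CP1) : rep p ≠ 0 := by
  induction p using OnePoint.rec <;> simp [Prod.ext_iff]

lemma IsLift.rep (p : CP1) : IsLift p (rep p) := ⟨1, one_ne_zero, by simp⟩

lemma IsLift.ne_zero {p : CP1} {a : ℂ × ℂ} (h : IsLift p a) : a ≠ 0 := by
  obtain ⟨c, hc, rfl⟩ := h
  exact smul_ne_zero hc (rep_ne_zero p)

lemma br_smul_left (c : ℂ) (a v : ℂ × ℂ) : br (c • a) v = c * br a v := by
  simp [br]; ring

lemma br_smul_right (c : ℂ) (a v : ℂ × ℂ) : br a (c • v) = c * br a v := by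
  simp [br]; ring

lemma exists_isLift {v : ℂ × ℂ} (hv : v ≠ 0) : ∃ p, IsLift p v := by
  obtain ⟨x, y⟩ := v
  by_cases hy : y = 0
  · subst hy
    have hx : x ≠ 0 := by rintro rfl; exact hv rfl
    exact ⟨OnePoint.infty, x, hx, by simp⟩
  · exact ⟨((x / y : ℂ) : CP1), -y, neg_ne_zero.2 hy, by simp; field_simp⟩

lemma br_rep_rep {p q : CP1} : br (rep p) (rep q) = 0 ↔ p = q := by
  induction p using OnePoint.rec with
  | infty => induction q using OnePoint.rec <;> simp [br]
  | coe a =>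
    induction q using OnePoint.rec with
    | infty => simp [br]
    | coe b =>
      simp only [br, rep_coe, OnePoint.coe_eq_coe]
      constructor <;> intro h <;> linear_combination h

lemma IsLift.br_eq_zero {p q : CP1} {a b : ℂ × ℂ} (ha : IsLift p a) (hb : IsLift q b) :
    br a b = 0 ↔ p = q := by
  obtain ⟨c, hc, rfl⟩ := ha
  obtain ⟨d, hd, rfl⟩ := hb
  rw [br_smul_left, br_smul_right, ← br_rep_rep]
  simp [hc, hd]

lemma eq_zero_of_br {a b v : ℂ × ℂ} (h : br a b ≠ 0) (ha : br a v = 0) (hb : br b v = 0) :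
    v = 0 := by
  simp only [br] at h ha hb
  ext
  · apply (mul_eq_zero.1 _).resolve_left h
    linear_combination b.1 * ha - a.1 * hb
  · apply (mul_eq_zero.1 _).resolve_left h
    linear_combination b.2 * ha - a.2 * hb

lemma IsLift.eq {p q : CP1} {a : ℂ × ℂ} (h : IsLift p a) (h' : IsLift q a) : p = q := by
  rw [← h.br_eq_zero h']; simp [br]; ring

namespace HasZeros

variable {G G₁ G₂ : ℂ × ℂ → ℂ} {Z Z₁ Z₂ : Finset CP1}

lemma eq_zero_iff (h : HasZeros G Z) {p : CP1} {v : ℂ × ℂ} (hv : IsLift p v) :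
    G v = 0 ↔ p ∈ Z := by
  obtain ⟨u, hu, h⟩ := h
  rw [h, mul_eq_zero, or_iff_right hu, Finset.prod_eq_zero_iff]
  constructor
  · rintro ⟨q, hq, h0⟩
    rwa [← ((IsLift.rep q).br_eq_zero hv).1 h0]
  · intro hp
    exact ⟨p, hp, ((IsLift.rep p).br_eq_zero hv).2 rfl⟩

lemma coe_eq (h : HasZeros G Z) : (Z : Set CP1) = {p | G (SphereConf.rep p) = 0} := by
  ext p
  exact (h.eq_zero_iff (IsLift.rep p)).symm

lemma unique (h : HasZeros G Z₁) (h' : HasZeros G Z₂) : Z₁ = Z₂ := by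
  rw [← Finset.coe_inj, h.coe_eq, h'.coe_eq]

lemma mul_of_disjoint (h₁ : HasZeros G₁ Z₁) (h₂ : HasZeros G₂ Z₂) (hd : Disjoint Z₁ Z₂) :
    HasZeros (fun v => G₁ v * G₂ v) (Z₁.disjUnion Z₂ hd) := by
  obtain ⟨u, hu, h₁⟩ := h₁
  obtain ⟨w, hw, h₂⟩ := h₂
  refine ⟨u * w, mul_ne_zero hu hw, fun v => ?_⟩
  simp only [h₁, h₂, Finset.prod_disjUnion]; ring

lemma const_mul {c : ℂ} (hc : c ≠ 0) (h : HasZeros G Z) : HasZeros (fun v => c * G v) Z := by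
  obtain ⟨u, hu, h⟩ := h
  exact ⟨c * u, mul_ne_zero hc hu, fun v => by simp only [h]; ring⟩

end HasZeros

namespace SimpleZeros

variable {G G₁ G₂ : ℂ × ℂ → ℂ} {m m₁ m₂ : ℕ}

lemma one : SimpleZeros 0 (fun _ => 1) := ⟨∅, rfl, 1, one_ne_zero, by simp⟩

lemma const_mul {c : ℂ} (hc : c ≠ 0) (h : SimpleZeros m G) : SimpleZeros m (fun v => c * G v) := by
  obtain ⟨Z, hZ, h⟩ := h
  exact ⟨Z, hZ, h.const_mul hc⟩

lemma mul (h₁ : SimpleZeros m₁ G₁) (h₂ : SimpleZeros m₂ G₂)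
    (h : ∀ v ≠ 0, G₁ v = 0 → G₂ v ≠ 0) : SimpleZeros (m₁ + m₂) (fun v => G₁ v * G₂ v) := by
  obtain ⟨Z₁, rfl, h₁⟩ := h₁
  obtain ⟨Z₂, rfl, h₂⟩ := h₂
  have hd : Disjoint Z₁ Z₂ := by
    rw [Finset.disjoint_left]
    intro p hp hp'
    exact h _ (rep_ne_zero p) ((h₁.eq_zero_iff (.rep p)).2 hp) ((h₂.eq_zero_iff (.rep p)).2 hp')
  exact ⟨_, Finset.card_disjUnion _ _ hd, h₁.mul_of_disjoint h₂ hd⟩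

lemma prod {ι : Type*} (s : Finset ι) {F : ι → ℂ × ℂ → ℂ}
    (hF : ∀ i ∈ s, SimpleZeros m (F i))
    (h : ∀ i ∈ s, ∀ j ∈ s, i ≠ j → ∀ v ≠ 0, F i v = 0 → F j v ≠ 0) :
    SimpleZeros (s.card * m) (fun v => ∏ i ∈ s, F i v) := by
  classical
  induction s using Finset.induction_on with
  | empty => simpa using one
  | insert i s hi ih =>
    simp only [Finset.prod_insert hi, Finset.card_insert_of_notMem hi]
    rw [add_mul, one_mul, add_comm]
    refine (hF i (by simp)).mul (ih (fun j hj => hF j (by simp [hj])) fun j hj k hk =>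
      h j (by simp [hj]) k (by simp [hk])) fun v hv h0 => ?_
    rw [Finset.prod_ne_zero_iff]
    intro j hj
    exact h i (by simp) j (by simp [hj]) (by rintro rfl; exact hi hj) v hv h0

lemma pow_of_le_one (h : SimpleZeros m G) {k : ℕ} (hk : k ≤ 1) :
    SimpleZeros (k * m) (fun v => G v ^ k) := by
  obtain rfl | rfl : k = 0 ∨ k = 1 := by omega
  · simpa using one
  · simpa using h

lemma linear {a : ℂ × ℂ} (ha : a ≠ 0) : SimpleZeros 1 (br a) := by
  obtain ⟨p, c, hc, rfl⟩ := exists_isLift ha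
  exact ⟨{p}, by simp, c, hc, fun v => by simp [br_smul_left]⟩

lemma quadratic {a b c : ℂ} (h : b ^ 2 - 4 * a * c ≠ 0)
    (hG : ∀ v, G v = a * v.1 ^ 2 + b * (v.1 * v.2) + c * v.2 ^ 2) : SimpleZeros 2 G := by
  obtain ⟨d, hd⟩ := IsAlgClosed.exists_pow_nat_eq (b ^ 2 - 4 * a * c) two_pos
  have hd0 : d ≠ 0 := by rintro rfl; exact h (by simpa using hd.symm)
  suffices ∃ r s : ℂ × ℂ, br r s ≠ 0 ∧ ∃ u : ℂ, u ≠ 0 ∧ ∀ v, G v = u * (br r v * br s v) by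
    obtain ⟨r, s, hrs, u, hu, hG⟩ := this
    rw [funext hG]
    refine const_mul hu (m := 1 + 1) ((linear ?_).mul (linear ?_) ?_)
    · rintro rfl; simp [br] at hrs
    · rintro rfl; simp [br] at hrs
    · intro v hv hr hs
      exact hv (eq_zero_of_br hrs hr hs)
  -- If a = 0, one of the zeros is ∞ and v.2 splits off. Otherwise the quadratic formula gives 4aG =
  -- (2a v.1 + (b - d) v.2)(2a v.1 + (b + d) v.2).
  by_cases ha : a = 0
  · subst ha
    have hb : b ≠ 0 := by rintro rfl; simp at h
    refine ⟨(1, 0), (c, -b), by simpa [br] using hb, 1, one_ne_zero, fun v => ?_⟩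
    rw [hG]; simp [br]; ring
  · refine ⟨(b - d, -(2 * a)), (b + d, -(2 * a)), ?_, (4 * a)⁻¹, by simpa using ha, fun v => ?_⟩
    · simp only [br]
      intro h0
      have : a * d = 0 := by linear_combination h0 / 4
      simp_all
    · rw [hG]
      simp only [br]
      field_simp
      linear_combination (v.2 ^ 2) * hd

/-- A form `p(α, β)`, homogenized, with `p` a polynomial without multiple roots. -/
lemma of_poly {r : ℕ} {p : ℂ[X]} (hp : p.Monic)
    (hsep : ∀ x, p.eval x = 0 → p.derivative.eval x ≠ 0) {α β : ℂ × ℂ → ℂ}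
    (hG : ∀ v, β v ≠ 0 → G v = β v ^ p.natDegree * p.eval (α v / β v))
    (hG0 : ∀ v, β v = 0 → G v = α v ^ p.natDegree)
    (hκ : ∀ κ, p.eval κ = 0 → SimpleZeros r (fun v => α v - κ * β v))
    (hind : ∀ v ≠ 0, β v = 0 → α v ≠ 0) : SimpleZeros (p.natDegree * r) G := by
  classical
  have hnodup : p.roots.Nodup := by
    rw [Multiset.nodup_iff_count_le_one]
    intro x
    rw [Polynomial.count_roots]
    by_contra! hlt
    obtain ⟨h1, h2⟩ := (Polynomial.one_lt_rootMultiplicity_iff_isRoot hp.ne_zero).1 hlt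
    exact hsep x h1 h2
  have hsplit := IsAlgClosed.splits p
  have hdeg : p.roots.toFinset.card = p.natDegree := by
    rw [Multiset.toFinset_card_of_nodup hnodup]
    exact hsplit.natDegree_eq_card_roots.symm
  have hprod : ∀ x, p.eval x = ∏ κ ∈ p.roots.toFinset, (x - κ) := by
    intro x
    conv_lhs => rw [hsplit.eq_prod_roots]
    rw [hp.leadingCoeff, map_one, one_mul, Polynomial.eval_multiset_prod, Multiset.map_map,
      Finset.prod_eq_multiset_prod, Multiset.toFinset_val, hnodup.dedup]
    simp
  -- The homogenization of ∏ (x - κ) is ∏ (α - κβ). Where β vanishes it is the power of α prescribed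
  -- by `hG0`, since p is monic.
  have hGe : G = fun v => ∏ κ ∈ p.roots.toFinset, (α v - κ * β v) := by
    funext v
    by_cases hv : β v = 0
    · simp [hG0 v hv, hv, hdeg]
    · rw [hG v hv, hprod, ← hdeg, ← Finset.prod_const, ← Finset.prod_mul_distrib]
      refine Finset.prod_congr rfl fun κ _ => ?_
      field_simp
  rw [hGe, ← hdeg]
  have hroot : ∀ κ ∈ p.roots.toFinset, p.eval κ = 0 := fun κ h => by
    simpa [hp.ne_zero] using h
  refine prod _ (fun κ h => hκ κ (hroot κ h)) fun κ _ μ _ hne v hv h1 h2 => ?_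
  have hβ : β v = 0 := by
    have : (κ - μ) * β v = 0 := by linear_combination h2 - h1
    exact (mul_eq_zero.1 this).resolve_left (sub_ne_zero.2 hne)
  exact hind v hv hβ (by simpa [hβ] using h1)

end SimpleZeros
end SphereConf

/-! ### Topology of the projective line and of configuration spaces -/

namespace SphereConf

open Filter Topology

lemma exists_perm_of_range_eq {ι X : Type*} {f g : ι → X} (hf : f.Injective) (hg : g.Injective)
    (h : Set.range f = Set.range g) : ∃ τ : Equiv.Perm ι, g = f ∘ τ := by
  refine ⟨(Equiv.ofInjective g hg).trans ((Equiv.setCongr h.symm).trans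
    (Equiv.ofInjective f hf).symm), ?_⟩
  funext i
  simp [Equiv.apply_ofInjective_symm hf]

lemma Conf.ext_points {m : ℕ} {X : Type} {c d : Conf m X} (h : c.points = d.points) : c = d := by
  induction c using Quotient.inductionOn with | h z =>
  induction d using Quotient.inductionOn with | h w =>
  exact Quotient.sound (exists_perm_of_range_eq z.2 w.2 h)

lemma BiConf.ext {n m : ℕ} {X : Type} {c d : BiConf n m X} (h : oldPoints c = oldPoints d)
    (h' : newPoints c = newPoints d) : c = d := by
  induction c using Quotient.inductionOn with | h z =>
  induction d using Quotient.inductionOn with | h w =>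
  obtain ⟨σ, hσ⟩ := Quotient.exact h
  obtain ⟨τ, hτ⟩ := Quotient.exact h'
  refine Quotient.sound ⟨σ, τ, ?_⟩
  funext i
  cases i with
  | inl i => exact congrFun hσ i
  | inr i => exact congrFun hτ i

/-- Near any point of the projective line, homogeneous coordinates can be chosen continuously. -/
lemma exists_continuousAt_isLift (p₀ : CP1) :
    ∃ L : CP1 → ℂ × ℂ, ContinuousAt L p₀ ∧ ∀ p, IsLift p (L p) := by
  induction p₀ using OnePoint.rec with
  | infty =>
    -- The lift (1, 1/a) is continuous at ∞. Its value at a = 0 does not affect continuity there and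
    -- only has to represent 0.
    refine ⟨fun p => p.elim (1, 0) (fun a => if a = 0 then (0, 1) else (1, a⁻¹)), ?_, ?_⟩
    · rw [OnePoint.continuousAt_infty', coclosedCompact_eq_cocompact,
        ← Metric.cobounded_eq_cocompact]
      have h : Tendsto (fun a : ℂ => ((1 : ℂ), a⁻¹)) (Bornology.cobounded ℂ) (𝓝 (1, 0)) :=
        tendsto_const_nhds.prodMk_nhds tendsto_inv₀_cobounded
      refine h.congr' ?_
      filter_upwards [Bornology.eventually_ne_cobounded (0 : ℂ)] with a ha
      simp [ha]
    · intro p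
      induction p using OnePoint.rec with
      | infty => exact IsLift.rep _
      | coe a =>
        by_cases ha : a = 0
        · exact ⟨-1, by simp, by simp [ha]⟩
        · exact ⟨-a⁻¹, by simpa using ha, by simp [ha]⟩
  | coe a =>
    refine ⟨rep, ?_, IsLift.rep⟩
    rw [OnePoint.continuousAt_coe]
    exact (continuous_neg.prodMk continuous_const).continuousAt

/-- A distance-like function on the projective line. -/
def chord (p q : CP1) : ℝ := ‖br (rep p) (rep q)‖ / ‖rep q‖

lemma chord_nonneg (p q : CP1) : 0 ≤ chord p q := by unfold chord; positivity

lemma chord_eq_zero {p q : CP1} : chord p q = 0 ↔ p = q := by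
  simp [chord, br_rep_rep, rep_ne_zero]

lemma IsLift.chord_eq {q : CP1} {a : ℂ × ℂ} (h : IsLift q a) (p : CP1) :
    chord p q = ‖br (SphereConf.rep p) a‖ / ‖a‖ := by
  obtain ⟨c, hc, rfl⟩ := h
  rw [chord, br_smul_right, norm_mul, norm_smul, mul_div_mul_left _ _ (norm_ne_zero_iff.2 hc)]

lemma continuous_chord (p : CP1) : Continuous (chord p) := by
  rw [continuous_iff_continuousAt]
  intro q₀
  obtain ⟨L, hL, hl⟩ := exists_continuousAt_isLift q₀
  have : chord p = fun q => ‖br (rep p) (L q)‖ / ‖L q‖ := funext fun q => (hl q).chord_eq p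
  rw [this]
  refine ContinuousAt.div ?_ hL.norm (norm_ne_zero_iff.2 (hl q₀).ne_zero)
  unfold br
  fun_prop

/-- By compactness it suffices to identify the cluster points of q, and φ vanishes at each of them.
-/
lemma tendsto_nhds_of_tendsto_zero {X Y : Type*} [TopologicalSpace Y] [CompactSpace Y]
    {φ : Y → ℝ} (hφ : Continuous φ) {y : Y} (hy : ∀ y', φ y' = 0 → y' = y) {l : Filter X}
    {q : X → Y} (h : Tendsto (fun x => φ (q x)) l (𝓝 0)) : Tendsto q l (𝓝 y) := by
  refine tendsto_nhds_of_unique_mapClusterPt fun y' h' => hy y' ?_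
  have h1 : MapClusterPt (φ y') l (φ ∘ q) := h'.continuousAt_comp hφ.continuousAt
  have h2 : ClusterPt (φ y') (𝓝 0) := ClusterPt.mono h1 h
  exact eq_of_nhds_neBot h2

/-- A convergence criterion that requires no labelling of the moving new points. If the product of
the distances from a limit point to all new points tends to 0, the nearest one converges to it. The
limit points are distinct, so the nearest-point indices eventually form a permutation, which
relabels the new points. -/
lemma tendsto_mk_biConf {X : Type*} {l : Filter X} {n m : ℕ}
    {z : X → PConf (Fin n ⊕ Fin m) CP1} {z₀ : PConf (Fin n ⊕ Fin m) CP1}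
    (hold : ∀ i, Tendsto (fun x => (z x).1 (.inl i)) l (𝓝 (z₀.1 (.inl i))))
    (hnew : ∀ i, Tendsto (fun x => ∏ j, chord (z₀.1 (.inr i)) ((z x).1 (.inr j))) l (𝓝 0)) :
    Tendsto (fun x => (Quotient.mk _ (z x) : BiConf n m CP1)) l (𝓝 (Quotient.mk _ z₀)) := by
  classical
  have hmin : ∀ x (i : Fin m), ∃ j, ∀ k,
      chord (z₀.1 (.inr i)) ((z x).1 (.inr j)) ≤ chord (z₀.1 (.inr i)) ((z x).1 (.inr k)) := by
    intro x i
    have : Nonempty (Fin m) := ⟨i⟩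
    exact Finite.exists_min _
  choose τ hτ using hmin
  have hlim : ∀ i, Tendsto (fun x => (z x).1 (.inr (τ x i))) l (𝓝 (z₀.1 (.inr i))) := by
    intro i
    refine tendsto_nhds_of_tendsto_zero ((continuous_chord (z₀.1 (.inr i))).pow m) ?_ ?_
    · intro y hy
      exact (chord_eq_zero.1 (pow_eq_zero_iff (Fin.pos i).ne' |>.1 hy)).symm
    · refine squeeze_zero (fun x => pow_nonneg (chord_nonneg _ _) _) (fun x => ?_) (hnew i)
      calc _ = ∏ _j : Fin m, chord (z₀.1 (.inr i)) ((z x).1 (.inr (τ x i))) := by simp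
        _ ≤ _ := Finset.prod_le_prod (fun _ _ => chord_nonneg _ _) fun k _ => hτ x i k
  have hinj : ∀ᶠ x in l, Function.Injective (τ x) := by
    have : ∀ i j : Fin m, i ≠ j → ∀ᶠ x in l, τ x i ≠ τ x j := by
      intro i j hij
      have hne : z₀.1 (.inr i) ≠ z₀.1 (.inr j) := fun h => hij (by simpa using z₀.2 h)
      have hmem := ((hlim i).prodMk_nhds (hlim j)).eventually
        (isClosed_diagonal.isOpen_compl.mem_nhds (by simpa using hne))
      filter_upwards [hmem] with x hx h
      exact hx (by rw [h]; rfl)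
    have h2 : ∀ᶠ x in l, ∀ i j : Fin m, i ≠ j → τ x i ≠ τ x j := by
      simp only [eventually_all]
      exact this
    filter_upwards [h2] with x hx i j h
    by_contra hne
    exact hx i j hne h
  let w : X → PConf (Fin n ⊕ Fin m) CP1 := fun x =>
    if h : Function.Injective (τ x) then
      ⟨(z x).1 ∘ Sum.map id (τ x), (z x).2.comp (Function.injective_id.sumMap h)⟩ else z x
  have hw : ∀ x, (Quotient.mk _ (z x) : BiConf n m CP1) = Quotient.mk _ (w x) := by
    intro x
    by_cases h : Function.Injective (τ x)
    · refine Quotient.sound ⟨1, Equiv.ofBijective _ (Finite.injective_iff_bijective.1 h), ?_⟩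
      simp only [w, dif_pos h]
      rfl
    · simp only [w, dif_neg h]
  simp only [hw]
  refine (continuous_quotient_mk'.tendsto z₀).comp ?_
  rw [tendsto_subtype_rng, tendsto_pi_nhds]
  have hwe : ∀ᶠ x in l, (w x).1 = (z x).1 ∘ Sum.map id (τ x) := by
    filter_upwards [hinj] with x hx
    simp only [w, dif_pos hx]
  rintro (i | i)
  · refine (hold i).congr' ?_
    filter_upwards [hwe] with x hx
    rw [hx]; rfl
  · refine (hlim i).congr' ?_
    filter_upwards [hwe] with x hx
    rw [hx]; rfl

/-! ### Families of binary forms and the sections they define -/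

/-- Pairwise independence of vectors of `ℂ²`. -/
def Indep {n : ℕ} (a : Fin n → ℂ × ℂ) : Prop := ∀ i j, i ≠ j → br (a i) (a j) ≠ 0

lemma Indep.of_isLift {n : ℕ} {z : PConf (Fin n) CP1} {a : Fin n → ℂ × ℂ}
    (ha : ∀ i, IsLift (z.1 i) (a i)) : Indep a := fun i j hij h =>
  hij (z.2 (((ha i).br_eq_zero (ha j)).1 h))

lemma indep_rep {n : ℕ} (z : PConf (Fin n) CP1) : Indep (rep ∘ z.1) :=
  .of_isLift fun i => .rep (z.1 i)

/-- A family of binary forms with `m` simple zeros, parametrized by configurations of `n` points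
of the projective line, all different from the zeros. -/
structure IsFormFamily (n m : ℕ) (G : (Fin n → ℂ × ℂ) → ℂ × ℂ → ℂ) : Prop where
  continuousAt : ∀ a, Indep a → ∀ v, ContinuousAt (fun a => G a v) a
  scale : ∀ a, Indep a → ∀ c : Fin n → ℂ, (∀ i, c i ≠ 0) →
    ∃ u : ℂ, u ≠ 0 ∧ ∀ v, G (fun i => c i • a i) v = u * G a v
  perm : ∀ a, Indep a → ∀ σ : Equiv.Perm (Fin n),
    ∃ u : ℂ, u ≠ 0 ∧ ∀ v, G (a ∘ σ) v = u * G a v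
  simpleZeros : ∀ a, Indep a → SimpleZeros m (G a)
  ne_zero : ∀ a, Indep a → ∀ i, G a (a i) ≠ 0

lemma norm_br_le (a b : ℂ × ℂ) : ‖br a b‖ ≤ 2 * ‖a‖ * ‖b‖ := by
  calc ‖br a b‖ ≤ ‖a.1 * b.2‖ + ‖a.2 * b.1‖ := norm_sub_le _ _
    _ ≤ ‖a‖ * ‖b‖ + ‖a‖ * ‖b‖ := by
      rw [norm_mul, norm_mul]
      gcongr
      exacts [norm_fst_le a, norm_snd_le b, norm_snd_le a, norm_fst_le b]
    _ = _ := by ring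

lemma norm_br_comm (a b : ℂ × ℂ) : ‖br a b‖ = ‖br b a‖ := by
  rw [← norm_neg]; congr 1; simp [br]; ring

/-- Up to the factor u and the norms of the representatives, the product of chords is |G| at p. The
value at a point w with G w ≠ 0 bounds these unknown factors from below, so the estimate involves
only values of G. -/
lemma HasZeros.prod_chord_le {G : ℂ × ℂ → ℂ} {Z : Finset CP1} (h : HasZeros G Z) (p : CP1)
    {w : ℂ × ℂ} (hw : G w ≠ 0) :
    ∏ q ∈ Z, chord p q ≤ ‖G (SphereConf.rep p)‖ * (2 * ‖w‖) ^ Z.card / ‖G w‖ := by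
  obtain ⟨u, hu, h⟩ := h
  have hN : 0 < ∏ q ∈ Z, ‖SphereConf.rep q‖ :=
    Finset.prod_pos fun q _ => norm_pos_iff.2 (rep_ne_zero q)
  have h1 : ∏ q ∈ Z, chord p q
      = (∏ q ∈ Z, ‖br (SphereConf.rep q) (SphereConf.rep p)‖) / ∏ q ∈ Z, ‖SphereConf.rep q‖ := by
    rw [← Finset.prod_div_distrib]
    exact Finset.prod_congr rfl fun q _ => by rw [chord, norm_br_comm]
  have h2 : ‖G w‖ ≤ ‖u‖ * ((2 * ‖w‖) ^ Z.card * ∏ q ∈ Z, ‖SphereConf.rep q‖) := by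
    rw [h, norm_mul, norm_prod, ← Finset.prod_const, ← Finset.prod_mul_distrib]
    gcongr with q
    exact (norm_br_le _ _).trans_eq (by ring)
  rw [h1, div_le_div_iff₀ hN (norm_pos_iff.2 hw), h (SphereConf.rep p), norm_mul, norm_prod]
  calc _ ≤ (∏ q ∈ Z, ‖br (SphereConf.rep q) (SphereConf.rep p)‖) *
        (‖u‖ * ((2 * ‖w‖) ^ Z.card * ∏ q ∈ Z, ‖SphereConf.rep q‖)) := by gcongr
    _ = _ := by ring

lemma HasZeros.exists_ne_zero {G : ℂ × ℂ → ℂ} {Z : Finset CP1} (h : HasZeros G Z) :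
    ∃ w, G w ≠ 0 := by
  have : Infinite CP1 := OnePoint.infinite
  obtain ⟨p, hp⟩ := Infinite.exists_notMem_finset Z
  exact ⟨_, mt (h.eq_zero_iff (.rep p)).1 hp⟩

namespace IsFormFamily

variable {n m : ℕ} {G : (Fin n → ℂ × ℂ) → ℂ × ℂ → ℂ}

lemma hasZeros_of_isLift (hG : IsFormFamily n m G) {z : PConf (Fin n) CP1} {Z : Finset CP1}
    (hZ : HasZeros (G (rep ∘ z.1)) Z) {a : Fin n → ℂ × ℂ} (ha : ∀ i, IsLift (z.1 i) (a i)) :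
    HasZeros (G a) Z := by
  choose c hc hca using ha
  obtain ⟨u, hu, h⟩ := hG.scale _ (indep_rep z) c hc
  have : a = fun i => c i • (rep ∘ z.1) i := funext hca
  rw [this, funext h]
  exact hZ.const_mul hu

/-- The zeros of a family of forms define a section. -/
theorem exists_section (hG : IsFormFamily n m G) :
    ∃ S : Conf n CP1 → BiConf n m CP1, IsSection S ∧ ∀ z : PConf (Fin n) CP1,
      ∃ p : PConf (Fin m) CP1, newPoints (S (Quotient.mk _ z)) = Quotient.mk _ p ∧
        HasZeros (G (rep ∘ z.1)) (Finset.univ.map ⟨p.1, p.2⟩) := by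
  classical
  choose Z hcard hZ using fun z : PConf (Fin n) CP1 => hG.simpleZeros _ (indep_rep z)
  let e : ∀ z, Fin m ≃ Z z := fun z => (Finset.equivFinOfCardEq (hcard z)).symm
  let p : PConf (Fin n) CP1 → PConf (Fin m) CP1 := fun z =>
    ⟨fun i => (e z i).1, Subtype.val_injective.comp (e z).injective⟩
  have hrange : ∀ z, Set.range (p z).1 = Z z := by
    intro z
    ext q
    constructor
    · rintro ⟨i, rfl⟩; exact (e z i).2
    · intro hq; exact ⟨(e z).symm ⟨q, hq⟩, by simp [p]⟩
  have hmap : ∀ z, Finset.univ.map ⟨(p z).1, (p z).2⟩ = Z z := by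
    intro z
    rw [← Finset.coe_inj, ← hrange]; simp
  have hprod : ∀ z (f : CP1 → ℝ), ∏ j, f ((p z).1 j) = ∏ q ∈ Z z, f q := by
    intro z f
    rw [← hmap, Finset.prod_map]; rfl
  have hdisj : ∀ z i j, z.1 i ≠ (p z).1 j := by
    intro z i j h
    refine hG.ne_zero _ (indep_rep z) i (((hZ z).eq_zero_iff (.rep _)).2 ?_)
    rw [h, ← Finset.mem_coe, ← hrange]
    exact ⟨j, rfl⟩
  let f : PConf (Fin n) CP1 → PConf (Fin n ⊕ Fin m) CP1 := fun z =>
    ⟨Sum.elim z.1 (p z).1, z.2.sumElim (p z).2 (hdisj z)⟩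
  have hwd : ∀ z w : PConf (Fin n) CP1, (confSetoid n CP1) z w →
      (Quotient.mk _ (f z) : BiConf n m CP1) = Quotient.mk _ (f w) := by
    rintro z w ⟨σ, hσ⟩
    have hZe : Z w = Z z := by
      refine (hZ w).unique ?_
      obtain ⟨u, hu, h⟩ := hG.perm _ (indep_rep z) σ
      rw [hσ, ← Function.comp_assoc, funext h]
      exact (hZ z).const_mul hu
    obtain ⟨τ, hτ⟩ := exists_perm_of_range_eq (p z).2 (p w).2 (by rw [hrange, hrange, hZe])
    refine Quotient.sound ⟨σ, τ, ?_⟩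
    funext i
    cases i with
    | inl i => exact congrFun hσ i
    | inr i => exact congrFun hτ i
  refine ⟨Quotient.lift (fun z => Quotient.mk _ (f z)) hwd, ⟨?_, ?_⟩, ?_⟩
  · refine Continuous.quotient_lift ?_ hwd
    rw [continuous_iff_continuousAt]
    intro z₀
    refine tendsto_mk_biConf ?_ ?_
    · intro i
      exact ((continuous_apply i).comp continuous_subtype_val).tendsto z₀
    · intro i
      -- `rep` jumps at ∞, so lifts continuous at the points of z₀ replace it. Rescaling the lifts
      -- does not change the zeros.
      choose L hL hl using fun i => exists_continuousAt_isLift (z₀.1 i)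
      let a : PConf (Fin n) CP1 → Fin n → ℂ × ℂ := fun z i => L i (z.1 i)
      have ha : ∀ z i, IsLift (z.1 i) (a z i) := fun z i => hl i (z.1 i)
      have hcont : ∀ v, ContinuousAt (fun z => G (a z) v) z₀ := by
        intro v
        refine ContinuousAt.comp (f := a) (g := fun b => G b v)
          (hG.continuousAt _ (.of_isLift (ha z₀)) v) ?_
        refine continuousAt_pi.2 fun j => ?_
        exact ContinuousAt.comp (f := fun z : PConf (Fin n) CP1 => z.1 j) (hL j)
          ((continuous_apply j).comp continuous_subtype_val).continuousAt
      have hza : ∀ z, HasZeros (G (a z)) (Z z) := fun z => hG.hasZeros_of_isLift (hZ z) (ha z)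
      obtain ⟨w, hw⟩ := (hza z₀).exists_ne_zero
      set y := (p z₀).1 i with hy
      have hy0 : G (a z₀) (rep y) = 0 := by
        rw [(hza z₀).eq_zero_iff (.rep _), ← Finset.mem_coe, ← hrange]
        exact ⟨i, rfl⟩
      -- The upper bound of `HasZeros.prod_chord_le` at a zero y of the limiting form; it tends to 0
      -- because G (a z) (rep y) does.
      have hlim : Tendsto (fun z => ‖G (a z) (rep y)‖ * (2 * ‖w‖) ^ m / ‖G (a z) w‖) (𝓝 z₀)
          (𝓝 0) := by
        have := Tendsto.div ((hcont (rep y)).norm.mul_const ((2 * ‖w‖) ^ m)) (hcont w).norm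
          (norm_ne_zero_iff.2 hw)
        simp only [hy0, norm_zero, zero_mul, zero_div] at this
        exact this
      refine squeeze_zero' (Eventually.of_forall fun z => Finset.prod_nonneg fun _ _ =>
        chord_nonneg _ _) ?_ hlim
      filter_upwards [(hcont w).eventually_ne hw] with z hz
      refine (hprod z (chord y)).trans_le ?_
      rw [← hcard z]
      exact (hza z).prod_chord_le y hz
  · intro c
    induction c using Quotient.inductionOn with | h z => rfl
  · intro z
    refine ⟨p z, rfl, ?_⟩
    rw [hmap]; exact hZ z

end IsFormFamily
end SphereConf

/-! ### Covariants of the binary quartic -/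

namespace SphereConf

open Filter Topology

namespace Quartic

/-- The three products of complementary brackets of four vectors. -/
def X₁ (a : Fin 4 → ℂ × ℂ) : ℂ := br (a 1) (a 2) * br (a 0) (a 3)
/-- A product of complementary brackets of four vectors. -/
def X₂ (a : Fin 4 → ℂ × ℂ) : ℂ := br (a 2) (a 0) * br (a 1) (a 3)
/-- A product of complementary brackets of four vectors. -/
def X₃ (a : Fin 4 → ℂ × ℂ) : ℂ := br (a 0) (a 1) * br (a 2) (a 3)

/-- The roots of the resolvent cubic. -/
def e₁ (a : Fin 4 → ℂ × ℂ) : ℂ := 4 / 3 * (X₂ a - X₁ a)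
/-- A root of the resolvent cubic. -/
def e₂ (a : Fin 4 → ℂ × ℂ) : ℂ := 4 / 3 * (X₁ a - X₃ a)
/-- A root of the resolvent cubic. -/
def e₃ (a : Fin 4 → ℂ × ℂ) : ℂ := 4 / 3 * (X₃ a - X₂ a)

/-- The quadratic forms vanishing at the fixed points of the three involutions that exchange
the four points in pairs. -/
def q₁ (a : Fin 4 → ℂ × ℂ) (v : ℂ × ℂ) : ℂ :=
  br (a 0) (a 2) * (br (a 1) v * br (a 3) v) + br (a 1) (a 3) * (br (a 0) v * br (a 2) v)
/-- A quadratic form vanishing at the fixed points of an involution that exchanges the four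
points in pairs. -/
def q₂ (a : Fin 4 → ℂ × ℂ) (v : ℂ × ℂ) : ℂ :=
  br (a 0) (a 1) * (br (a 2) v * br (a 3) v) + br (a 2) (a 3) * (br (a 0) v * br (a 1) v)
/-- A quadratic form vanishing at the fixed points of an involution that exchanges the four
points in pairs. -/
def q₃ (a : Fin 4 → ℂ × ℂ) (v : ℂ × ℂ) : ℂ :=
  br (a 0) (a 1) * (br (a 2) v * br (a 3) v) - br (a 2) (a 3) * (br (a 0) v * br (a 1) v)

/-- The binary quartic with the given zeros. -/
def form (a : Fin 4 → ℂ × ℂ) (v : ℂ × ℂ) : ℂ :=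
  br (a 0) v * br (a 1) v * br (a 2) v * br (a 3) v

/-- The Hessian covariant, normalized. -/
def hessian (a : Fin 4 → ℂ × ℂ) (v : ℂ × ℂ) : ℂ := (q₁ a v ^ 2 + q₂ a v ^ 2 + q₃ a v ^ 2) / 3

/-- The sextic covariant. -/
def sextic (a : Fin 4 → ℂ × ℂ) (v : ℂ × ℂ) : ℂ := q₁ a v * q₂ a v * q₃ a v

/-- The resolvent cubic is `x³ + A x + B`. -/
def coeffA (a : Fin 4 → ℂ × ℂ) : ℂ := e₁ a * e₂ a + e₂ a * e₃ a + e₃ a * e₁ a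
/-- A coefficient of the resolvent cubic `x³ + A x + B`. -/
def coeffB (a : Fin 4 → ℂ × ℂ) : ℂ := -(e₁ a * e₂ a * e₃ a)

/-- The covariant whose zeros lie over the `3`-torsion points of the Jacobian. -/
def threeTorsion (a : Fin 4 → ℂ × ℂ) (v : ℂ × ℂ) : ℂ :=
  hessian a v ^ 4 + 2 * coeffA a * hessian a v ^ 2 * form a v ^ 2
    + 4 * coeffB a * hessian a v * form a v ^ 3 - coeffA a ^ 2 / 3 * form a v ^ 4

/-- A positive function homogeneous of degree one in the four brackets. -/
def size (a : Fin 4 → ℂ × ℂ) : ℝ := ‖X₁ a‖ + ‖X₂ a‖ + ‖X₃ a‖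

/-- The square removes the sign under permutations. The degree 6 in X matches the exponent in
`level`, so that the phase of `disc` scales correctly. -/
def disc (a : Fin 4 → ℂ × ℂ) : ℂ := (X₁ a * X₂ a * X₃ a) ^ 2

/-- The sixth power of the points on the `j`-th circle around the old points. -/
def level (j : ℕ) (a : Fin 4 → ℂ × ℂ) : ℂ :=
  ((10 * (j + 1) * size a : ℝ) : ℂ) ^ 6 * (disc a / (‖disc a‖ : ℂ))

/-- The Plücker relation. It gives e₂ - e₁ = 4X₁, e₃ - e₂ = 4X₃ and e₁ - e₃ = 4X₂, so the eᵢ are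
distinct for distinct points. -/
lemma plucker (a : Fin 4 → ℂ × ℂ) : X₁ a + X₂ a + X₃ a = 0 := by
  simp only [X₁, X₂, X₃, br]; ring

lemma q₁_add_q₂ (a : Fin 4 → ℂ × ℂ) (v : ℂ × ℂ) :
    q₁ a v + q₂ a v = 2 * (br (a 0) (a 3) * (br (a 1) v * br (a 2) v)) := by
  simp only [q₁, q₂, br]; ring

lemma q₁_sub_q₂ (a : Fin 4 → ℂ × ℂ) (v : ℂ × ℂ) :
    q₁ a v - q₂ a v = 2 * (br (a 1) (a 2) * (br (a 0) v * br (a 3) v)) := by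
  simp only [q₁, q₂, br]; ring

lemma q₁_sub_q₃ (a : Fin 4 → ℂ × ℂ) (v : ℂ × ℂ) :
    q₁ a v - q₃ a v = 2 * (br (a 1) (a 3) * (br (a 0) v * br (a 2) v)) := by
  simp only [q₁, q₃, br]; ring

lemma q₂_add_q₃ (a : Fin 4 → ℂ × ℂ) (v : ℂ × ℂ) :
    q₂ a v + q₃ a v = 2 * (br (a 0) (a 1) * (br (a 2) v * br (a 3) v)) := by
  simp only [q₂, q₃]; ring

lemma q₂_sub_q₃ (a : Fin 4 → ℂ × ℂ) (v : ℂ × ℂ) :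
    q₂ a v - q₃ a v = 2 * (br (a 2) (a 3) * (br (a 0) v * br (a 1) v)) := by
  simp only [q₂, q₃]; ring

lemma sq_sub_sq₁₂ (a : Fin 4 → ℂ × ℂ) (v : ℂ × ℂ) :
    q₁ a v ^ 2 - q₂ a v ^ 2 = 4 * X₁ a * form a v := by
  rw [sq_sub_sq, q₁_add_q₂, q₁_sub_q₂, X₁, form]; ring

lemma sq_sub_sq₂₃ (a : Fin 4 → ℂ × ℂ) (v : ℂ × ℂ) :
    q₂ a v ^ 2 - q₃ a v ^ 2 = 4 * X₃ a * form a v := by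
  rw [sq_sub_sq, q₂_add_q₃, q₂_sub_q₃, X₃, form]; ring

/-- The squares qᵢ² differ by multiples of f, so all three lie in the pencil spanned by H and f.
They are its members H - κf at κ = eᵢ. -/
lemma hessian_eq₁ (a : Fin 4 → ℂ × ℂ) (v : ℂ × ℂ) :
    hessian a v = q₁ a v ^ 2 + e₁ a * form a v := by
  simp only [hessian, e₁]
  linear_combination -2 / 3 * sq_sub_sq₁₂ a v - 1 / 3 * sq_sub_sq₂₃ a v
    - 4 / 3 * form a v * plucker a

lemma hessian_eq₂ (a : Fin 4 → ℂ × ℂ) (v : ℂ × ℂ) :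
    hessian a v = q₂ a v ^ 2 + e₂ a * form a v := by
  simp only [hessian, e₂]
  linear_combination 1 / 3 * sq_sub_sq₁₂ a v - 1 / 3 * sq_sub_sq₂₃ a v

lemma hessian_eq₃ (a : Fin 4 → ℂ × ℂ) (v : ℂ × ℂ) :
    hessian a v = q₃ a v ^ 2 + e₃ a * form a v := by
  simp only [hessian, e₃]
  linear_combination 1 / 3 * sq_sub_sq₁₂ a v + 2 / 3 * sq_sub_sq₂₃ a v
    + 4 / 3 * form a v * plucker a

section Indep

variable {a : Fin 4 → ℂ × ℂ}

lemma X₁_ne_zero (ha : Indep a) : X₁ a ≠ 0 := mul_ne_zero (ha _ _ (by decide)) (ha _ _ (by decide))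
lemma X₂_ne_zero (ha : Indep a) : X₂ a ≠ 0 := mul_ne_zero (ha _ _ (by decide)) (ha _ _ (by decide))
lemma X₃_ne_zero (ha : Indep a) : X₃ a ≠ 0 := mul_ne_zero (ha _ _ (by decide)) (ha _ _ (by decide))

lemma e₁_ne_e₂ (ha : Indep a) : e₁ a ≠ e₂ a := fun h => X₁_ne_zero ha <| by
  simp only [e₁, e₂] at h
  linear_combination -1 / 4 * h + 1 / 3 * plucker a

lemma e₂_ne_e₃ (ha : Indep a) : e₂ a ≠ e₃ a := fun h => X₃_ne_zero ha <| by
  simp only [e₂, e₃] at h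
  linear_combination -1 / 4 * h + 1 / 3 * plucker a

lemma e₃_ne_e₁ (ha : Indep a) : e₃ a ≠ e₁ a := fun h => X₂_ne_zero ha <| by
  simp only [e₁, e₃] at h
  linear_combination -1 / 4 * h + 1 / 3 * plucker a

/-- The pencil has no base points. At a common zero of H and f all qᵢ vanish, hence so do all
products of two of the linear forms of a 0, a 1, a 2. Then two of these independent linear forms
vanish. -/
lemma hessian_ne_zero (ha : Indep a) {v : ℂ × ℂ} (hv : v ≠ 0) (h : form a v = 0) : hessian a v ≠ 0 := by
  intro hH
  have h1 : q₁ a v = 0 := by simpa [h, hH] using (hessian_eq₁ a v).symm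
  have h2 : q₂ a v = 0 := by simpa [h, hH] using (hessian_eq₂ a v).symm
  have h3 : q₃ a v = 0 := by simpa [h, hH] using (hessian_eq₃ a v).symm
  have k12 := q₁_add_q₂ a v
  have k02 := q₁_sub_q₃ a v
  have k01 := q₂_sub_q₃ a v
  simp only [h1, h2, h3, add_zero, sub_zero, zero_eq_mul, mul_eq_zero, two_ne_zero, false_or,
    ha 0 3 (by decide), ha 1 3 (by decide), ha 2 3 (by decide)] at k12 k02 k01
  by_cases h0 : br (a 0) v = 0
  · rcases k12 with h | h
    · exact hv (eq_zero_of_br (ha 0 1 (by decide)) h0 h)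
    · exact hv (eq_zero_of_br (ha 0 2 (by decide)) h0 h)
  · exact hv (eq_zero_of_br (ha 1 2 (by decide)) (k01.resolve_left h0) (k02.resolve_left h0))

/-- The discriminant of s q₁ + t q₂ is -4X₁(s²X₂ + t²X₃). There is no term in st because q₁ and q₂
are orthogonal for the polarized discriminant. -/
lemma simpleZeros_comb {s t : ℂ} (h : X₁ a * (s ^ 2 * X₂ a + t ^ 2 * X₃ a) ≠ 0) :
    SimpleZeros 2 (fun v => s * q₁ a v + t * q₂ a v) := by
  refine SimpleZeros.quadratic
    (a := s * (br (a 0) (a 2) * ((a 1).2 * (a 3).2) + br (a 1) (a 3) * ((a 0).2 * (a 2).2))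
      + t * (br (a 0) (a 1) * ((a 2).2 * (a 3).2) + br (a 2) (a 3) * ((a 0).2 * (a 1).2)))
    (b := -(s * (br (a 0) (a 2) * ((a 1).1 * (a 3).2 + (a 1).2 * (a 3).1)
        + br (a 1) (a 3) * ((a 0).1 * (a 2).2 + (a 0).2 * (a 2).1))
      + t * (br (a 0) (a 1) * ((a 2).1 * (a 3).2 + (a 2).2 * (a 3).1)
        + br (a 2) (a 3) * ((a 0).1 * (a 1).2 + (a 0).2 * (a 1).1))))
    (c := s * (br (a 0) (a 2) * ((a 1).1 * (a 3).1) + br (a 1) (a 3) * ((a 0).1 * (a 2).1))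
      + t * (br (a 0) (a 1) * ((a 2).1 * (a 3).1) + br (a 2) (a 3) * ((a 0).1 * (a 1).1)))
    ?_ fun v => ?_
  · convert mul_ne_zero (show (-4 : ℂ) ≠ 0 by norm_num) h using 1
    simp only [X₁, X₂, X₃, br]
    ring
  · simp only [q₁, q₂, br]
    ring

lemma simpleZeros_q₁ (ha : Indep a) : SimpleZeros 2 (q₁ a) := by
  simpa using simpleZeros_comb (a := a) (s := 1) (t := 0)
    (by simpa using ⟨X₁_ne_zero ha, X₂_ne_zero ha⟩)

lemma simpleZeros_q₂ (ha : Indep a) : SimpleZeros 2 (q₂ a) := by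
  simpa using simpleZeros_comb (a := a) (s := 0) (t := 1)
    (by simpa using ⟨X₁_ne_zero ha, X₃_ne_zero ha⟩)

lemma simpleZeros_q₃ (ha : Indep a) : SimpleZeros 2 (q₃ a) := by
  refine SimpleZeros.quadratic
    (a := br (a 0) (a 1) * ((a 2).2 * (a 3).2) - br (a 2) (a 3) * ((a 0).2 * (a 1).2))
    (b := -(br (a 0) (a 1) * ((a 2).1 * (a 3).2 + (a 2).2 * (a 3).1)
        - br (a 2) (a 3) * ((a 0).1 * (a 1).2 + (a 0).2 * (a 1).1)))
    (c := br (a 0) (a 1) * ((a 2).1 * (a 3).1) - br (a 2) (a 3) * ((a 0).1 * (a 1).1))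
    ?_ fun v => ?_
  · convert mul_ne_zero (show (-4 : ℂ) ≠ 0 by norm_num)
      (mul_ne_zero (X₂_ne_zero ha) (X₃_ne_zero ha)) using 1
    simp only [X₂, X₃, br]
    ring
  · simp only [q₃, br]
    ring

lemma eq_zero_of_two_pencil (ha : Indep a) {κ μ : ℂ} (hne : κ ≠ μ) {v : ℂ × ℂ}
    (h : hessian a v = κ * form a v) (h' : hessian a v = μ * form a v) : v = 0 := by
  by_contra hv
  have hf : form a v = 0 :=
    (mul_eq_zero.1 (show (κ - μ) * form a v = 0 by linear_combination h' - h)).resolve_left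
      (sub_ne_zero.2 hne)
  exact hessian_ne_zero ha hv hf (by simpa [hf] using h)

lemma simpleZeros_sextic (ha : Indep a) : SimpleZeros 6 (sextic a) := by
  refine ((simpleZeros_q₁ ha).mul (simpleZeros_q₂ ha) ?_).mul (simpleZeros_q₃ ha) ?_
  · intro v hv h1 h2
    exact hv (eq_zero_of_two_pencil ha (e₁_ne_e₂ ha) (by simp [hessian_eq₁, h1])
      (by simp [hessian_eq₂, h2]))
  · intro v hv h12 h3
    rcases mul_eq_zero.1 h12 with h | h
    · exact hv (eq_zero_of_two_pencil ha (e₃_ne_e₁ ha) (by simp [hessian_eq₃, h3])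
        (by simp [hessian_eq₁, h]))
    · exact hv (eq_zero_of_two_pencil ha (e₂_ne_e₃ ha) (by simp [hessian_eq₂, h])
        (by simp [hessian_eq₃, h3]))

lemma exists_of_sextic_eq_zero {v : ℂ × ℂ} (h : sextic a v = 0) :
    ∃ e, (e = e₁ a ∨ e = e₂ a ∨ e = e₃ a) ∧ hessian a v = e * form a v := by
  rcases mul_eq_zero.1 h with h12 | h3
  · rcases mul_eq_zero.1 h12 with h | h
    · exact ⟨_, .inl rfl, by simp [hessian_eq₁, h]⟩
    · exact ⟨_, .inr (.inl rfl), by simp [hessian_eq₂, h]⟩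
  · exact ⟨_, .inr (.inr rfl), by simp [hessian_eq₃, h3]⟩

/-- Eliminating f between q₁² = H - e₁f and q₂² = H - e₂f writes H - κf as s²q₁² - t²q₂² with s² =
(e₂ - κ)/(4X₁) and t² = (e₁ - κ)/(4X₁). The two factors s q₁ ± t q₂ have discriminant -X₁(κ - e₃),
and a common zero would be one of q₁ and q₂. -/
lemma simpleZeros_pencil (ha : Indep a) {κ : ℂ} (h₁ : κ ≠ e₁ a) (h₂ : κ ≠ e₂ a) (h₃ : κ ≠ e₃ a) :
    SimpleZeros 4 (fun v => hessian a v - κ * form a v) := by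
  have hX := X₁_ne_zero ha
  obtain ⟨s, hs⟩ := IsAlgClosed.exists_pow_nat_eq ((e₂ a - κ) / (4 * X₁ a)) two_pos
  obtain ⟨t, ht⟩ := IsAlgClosed.exists_pow_nat_eq ((e₁ a - κ) / (4 * X₁ a)) two_pos
  have hs0 : s ≠ 0 := by
    rintro rfl
    rw [zero_pow two_ne_zero, eq_comm, div_eq_zero_iff] at hs
    rcases hs with hs | hs
    · exact h₂ (by linear_combination -hs)
    · simp [hX] at hs
  have ht0 : t ≠ 0 := by
    rintro rfl
    rw [zero_pow two_ne_zero, eq_comm, div_eq_zero_iff] at ht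
    rcases ht with ht | ht
    · exact h₁ (by linear_combination -ht)
    · simp [hX] at ht
  field_simp at hs ht
  have hst : X₁ a * (s ^ 2 * X₂ a + t ^ 2 * X₃ a) ≠ 0 := by
    have : X₁ a * (s ^ 2 * X₂ a + t ^ 2 * X₃ a) = X₁ a * (κ - e₃ a) / 4 := by
      simp only [e₁, e₂, e₃] at *
      linear_combination X₂ a / 4 * hs + X₃ a / 4 * ht - κ / 4 * plucker a
    rw [this]
    exact div_ne_zero (mul_ne_zero hX (sub_ne_zero.2 h₃)) (by norm_num)
  have hfact : (fun v => hessian a v - κ * form a v)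
      = fun v => (s * q₁ a v + t * q₂ a v) * (s * q₁ a v + -t * q₂ a v) := by
    funext v
    apply mul_left_cancel₀ (mul_ne_zero (show (4 : ℂ) ≠ 0 by norm_num) hX)
    have h12 : e₂ a - e₁ a = 4 * X₁ a := by
      simp only [e₁, e₂]; linear_combination -4 / 3 * plucker a
    have k1 := hessian_eq₁ a v
    have k2 := hessian_eq₂ a v
    linear_combination -q₁ a v ^ 2 * hs + q₂ a v ^ 2 * ht - (hessian a v - κ * form a v) * h12
      + (e₂ a - κ) * k1 - (e₁ a - κ) * k2
  rw [hfact]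
  refine (simpleZeros_comb hst).mul (simpleZeros_comb (by rwa [neg_sq])) fun v hv h h' => ?_
  have k1 : q₁ a v = 0 := by
    apply (mul_eq_zero.1 _).resolve_left (mul_ne_zero two_ne_zero hs0)
    linear_combination h + h'
  have k2 : q₂ a v = 0 := by
    apply (mul_eq_zero.1 _).resolve_left (mul_ne_zero two_ne_zero ht0)
    linear_combination h - h'
  exact hv (eq_zero_of_two_pencil ha (e₁_ne_e₂ ha) (by simp [hessian_eq₁, k1])
      (by simp [hessian_eq₂, k2]))

end Indep
end Quartic
end SphereConf

/-! ### Forms lying over the 3-torsion values and over circles -/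

namespace SphereConf

open Filter Topology
namespace Quartic

section Indep
variable {a : Fin 4 → ℂ × ℂ}

lemma resolvent_eq (a : Fin 4 → ℂ × ℂ) (x : ℂ) :
    x ^ 3 + coeffA a * x + coeffB a = (x - e₁ a) * (x - e₂ a) * (x - e₃ a) := by
  simp only [coeffA, coeffB, e₁, e₂, e₃]; ring

lemma resolvent_deriv_ne_zero (ha : Indep a) {x : ℂ} (hx : x ^ 3 + coeffA a * x + coeffB a = 0) :
    3 * x ^ 2 + coeffA a ≠ 0 := by
  have h12 := sub_ne_zero.2 (e₁_ne_e₂ ha)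
  have h23 := sub_ne_zero.2 (e₂_ne_e₃ ha)
  have h31 := sub_ne_zero.2 (e₃_ne_e₁ ha)
  have hs : e₁ a + e₂ a + e₃ a = 0 := by simp only [e₁, e₂, e₃]; ring
  rw [resolvent_eq, mul_eq_zero, mul_eq_zero, sub_eq_zero, sub_eq_zero, sub_eq_zero] at hx
  rcases hx with (rfl | rfl) | rfl
  · convert neg_ne_zero.2 (mul_ne_zero h12 h31) using 1
    simp only [coeffA]; linear_combination 2 * e₁ a * hs
  · convert neg_ne_zero.2 (mul_ne_zero h12 h23) using 1
    simp only [coeffA]; linear_combination 2 * e₂ a * hs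
  · convert neg_ne_zero.2 (mul_ne_zero h23 h31) using 1
    simp only [coeffA]; linear_combination 2 * e₃ a * hs

/-- With g = x³ + Ax + B, the 3-division polynomial is 12xg - g'². A common root with g would be a
multiple root of g. -/
lemma ne_root_of_threeTorsion (ha : Indep a) {x : ℂ}
    (hx : x ^ 4 + 2 * coeffA a * x ^ 2 + 4 * coeffB a * x - coeffA a ^ 2 / 3 = 0) :
    x ^ 3 + coeffA a * x + coeffB a ≠ 0 := by
  intro h
  refine resolvent_deriv_ne_zero ha h (pow_eq_zero_iff two_ne_zero |>.1 ?_)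
  linear_combination 12 * x * h - 3 * hx

open Polynomial in
lemma simpleZeros_threeTorsion (ha : Indep a) : SimpleZeros 16 (threeTorsion a) := by
  set p : ℂ[X] := X ^ 4 + C (2 * coeffA a) * X ^ 2 + C (4 * coeffB a) * X - C (coeffA a ^ 2 / 3)
    with hp
  have hdeg : p.natDegree = 4 := by rw [hp]; compute_degree!
  have hmon : p.Monic := by rw [hp]; monicity!
  have heval : ∀ x, p.eval x
      = x ^ 4 + 2 * coeffA a * x ^ 2 + 4 * coeffB a * x - coeffA a ^ 2 / 3 := by
    intro x; simp [hp]
  have key : SimpleZeros (p.natDegree * 4) (threeTorsion a) := by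
    refine SimpleZeros.of_poly (α := hessian a) (β := form a) hmon ?_ ?_ ?_ ?_ ?_
    · intro x hx
      rw [heval] at hx
      have := ne_root_of_threeTorsion ha hx
      -- The derivative of p is 4(x³ + Ax + B).
      convert mul_ne_zero (show (4 : ℂ) ≠ 0 by norm_num) this using 1
      simp [hp]; ring
    · intro v hv
      rw [hdeg, heval, threeTorsion]
      field_simp
    · intro v hv
      simp [hdeg, threeTorsion, hv]
    · intro κ hκ
      rw [heval] at hκ
      have := ne_root_of_threeTorsion ha hκ
      rw [resolvent_eq, mul_ne_zero_iff, mul_ne_zero_iff, sub_ne_zero, sub_ne_zero,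
        sub_ne_zero] at this
      exact simpleZeros_pencil ha this.1.1 this.1.2 this.2
    · exact fun v hv h => hessian_ne_zero ha hv h
  rwa [hdeg] at key

lemma size_pos (ha : Indep a) : 0 < size a := by
  have := norm_pos_iff.2 (X₁_ne_zero ha)
  unfold size; positivity

lemma disc_ne_zero (ha : Indep a) : disc a ≠ 0 :=
  pow_ne_zero _ (mul_ne_zero (mul_ne_zero (X₁_ne_zero ha) (X₂_ne_zero ha)) (X₃_ne_zero ha))

lemma norm_level (ha : Indep a) (j : ℕ) : ‖level j a‖ = (10 * (j + 1) * size a) ^ 6 := by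
  have := size_pos ha
  rw [level, norm_mul, norm_pow, Complex.norm_real, norm_div, Complex.norm_real, norm_norm,
    div_self (norm_ne_zero_iff.2 (disc_ne_zero ha)), mul_one, Real.norm_of_nonneg (by positivity)]

lemma norm_of_pow_eq_level (ha : Indep a) {j : ℕ} {x : ℂ} (hx : x ^ 6 = level j a) :
    ‖x‖ = 10 * (j + 1) * size a := by
  have := size_pos ha
  rw [← pow_left_inj₀ (norm_nonneg x) (by positivity) (show 6 ≠ 0 by norm_num), ← norm_pow, hx,
    norm_level ha]

lemma norm_e₁_le (a : Fin 4 → ℂ × ℂ) : ‖e₁ a‖ ≤ 4 / 3 * size a := by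
  have := norm_sub_le (X₂ a) (X₁ a)
  have := norm_nonneg (X₃ a)
  rw [e₁, norm_mul, size]; norm_num; linarith

lemma norm_e₂_le (a : Fin 4 → ℂ × ℂ) : ‖e₂ a‖ ≤ 4 / 3 * size a := by
  have := norm_sub_le (X₁ a) (X₃ a)
  have := norm_nonneg (X₂ a)
  rw [e₂, norm_mul, size]; norm_num; linarith

lemma norm_e₃_le (a : Fin 4 → ℂ × ℂ) : ‖e₃ a‖ ≤ 4 / 3 * size a := by
  have := norm_sub_le (X₃ a) (X₂ a)
  have := norm_nonneg (X₁ a)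
  rw [e₃, norm_mul, size]; norm_num; linarith

lemma size_nonneg (a : Fin 4 → ℂ × ℂ) : 0 ≤ size a := by unfold size; positivity

lemma norm_coeffA_le (a : Fin 4 → ℂ × ℂ) : ‖coeffA a‖ ≤ 6 * size a ^ 2 := by
  have hs := size_nonneg a
  calc ‖coeffA a‖ ≤ ‖e₁ a‖ * ‖e₂ a‖ + ‖e₂ a‖ * ‖e₃ a‖ + ‖e₃ a‖ * ‖e₁ a‖ := by
        simp only [← norm_mul]; exact norm_add₃_le
    _ ≤ 4 / 3 * size a * (4 / 3 * size a) + 4 / 3 * size a * (4 / 3 * size a)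
        + 4 / 3 * size a * (4 / 3 * size a) := by
      gcongr <;> first | exact norm_e₁_le a | exact norm_e₂_le a | exact norm_e₃_le a
    _ ≤ _ := by nlinarith [sq_nonneg (size a)]

lemma norm_coeffB_le (a : Fin 4 → ℂ × ℂ) : ‖coeffB a‖ ≤ 3 * size a ^ 3 := by
  have hs := size_nonneg a
  calc ‖coeffB a‖ = ‖e₁ a‖ * ‖e₂ a‖ * ‖e₃ a‖ := by simp [coeffB]
    _ ≤ 4 / 3 * size a * (4 / 3 * size a) * (4 / 3 * size a) := by
      gcongr <;> first | exact norm_e₁_le a | exact norm_e₂_le a | exact norm_e₃_le a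
    _ ≤ _ := by nlinarith [pow_nonneg hs 3]

/-- The roots of the three-torsion polynomial are smaller than those on the circles. -/
lemma norm_lt_of_threeTorsion (ha : Indep a) {x : ℂ}
    (hx : x ^ 4 + 2 * coeffA a * x ^ 2 + 4 * coeffB a * x - coeffA a ^ 2 / 3 = 0) :
    ‖x‖ < 10 * size a := by
  have hs := size_pos ha
  by_contra! hlt
  have h1 : ‖x‖ ^ 4 ≤ 12 * size a ^ 2 * ‖x‖ ^ 2 + 12 * size a ^ 3 * ‖x‖ + 12 * size a ^ 4 := by
    calc ‖x‖ ^ 4 = ‖-(2 * coeffA a * x ^ 2) + -(4 * coeffB a * x) + coeffA a ^ 2 / 3‖ := by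
          rw [← norm_pow]; congr 1; linear_combination hx
      _ ≤ ‖-(2 * coeffA a * x ^ 2)‖ + ‖-(4 * coeffB a * x)‖ + ‖coeffA a ^ 2 / 3‖ := norm_add₃_le
      _ = 2 * ‖coeffA a‖ * ‖x‖ ^ 2 + 4 * ‖coeffB a‖ * ‖x‖ + ‖coeffA a‖ ^ 2 / 3 := by simp
      _ ≤ 2 * (6 * size a ^ 2) * ‖x‖ ^ 2 + 4 * (3 * size a ^ 3) * ‖x‖
          + (6 * size a ^ 2) ^ 2 / 3 := by
        gcongr <;> first | exact norm_coeffA_le a | exact norm_coeffB_le a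
      _ = _ := by ring
  -- If |x| ≥ 10 · size, the lower terms are at most (0.12 + 0.012 + 0.0012)|x|⁴, which is less than
  -- |x|⁴.
  have h2 : size a ≤ ‖x‖ / 10 := by linarith
  have hx0 : 0 < ‖x‖ := by linarith
  have h3 : 12 * size a ^ 2 * ‖x‖ ^ 2 + 12 * size a ^ 3 * ‖x‖ + 12 * size a ^ 4
      ≤ 12 * (‖x‖ / 10) ^ 2 * ‖x‖ ^ 2 + 12 * (‖x‖ / 10) ^ 3 * ‖x‖ + 12 * (‖x‖ / 10) ^ 4 := by
    gcongr
  have : 0 < ‖x‖ ^ 4 := by positivity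
  nlinarith

/-- The zeros on the `j`-th circle. -/
def circle (j : ℕ) (a : Fin 4 → ℂ × ℂ) (v : ℂ × ℂ) : ℂ :=
  hessian a v ^ 6 - level j a * form a v ^ 6

open Polynomial in
lemma simpleZeros_circle (ha : Indep a) (j : ℕ) : SimpleZeros 24 (circle j a) := by
  have hs := size_pos ha
  have hj : (0 : ℝ) ≤ j := j.cast_nonneg
  have hc : level j a ≠ 0 := by
    rw [← norm_ne_zero_iff, norm_level ha]; positivity
  have key : SimpleZeros ((X ^ 6 - C (level j a)).natDegree * 4) (circle j a) := by
    refine SimpleZeros.of_poly (α := hessian a) (β := form a)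
      (monic_X_pow_sub_C _ (by norm_num)) ?_ ?_ ?_ ?_ ?_
    · intro x hx
      have hx0 : x ≠ 0 := by
        rintro rfl
        simp [hc] at hx
      norm_num [hx0]
    · intro v hv
      simp only [natDegree_X_pow_sub_C, eval_sub, eval_pow, eval_X, eval_C, circle]
      field_simp
    · intro v hv
      simp [circle, hv]
    · intro κ hκ
      have hn := norm_of_pow_eq_level ha (x := κ) (j := j) (by simpa [sub_eq_zero] using hκ)
      -- The radius exceeds the bound 4/3 · size on the branch values.
      have hlt : 4 / 3 * size a < ‖κ‖ := by rw [hn]; nlinarith [mul_nonneg hj hs.le]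
      refine simpleZeros_pencil ha ?_ ?_ ?_ <;> rintro rfl
      · exact absurd (norm_e₁_le a) (not_le.2 hlt)
      · exact absurd (norm_e₂_le a) (not_le.2 hlt)
      · exact absurd (norm_e₃_le a) (not_le.2 hlt)
    · exact fun v hv h => hessian_ne_zero ha hv h
  rwa [natDegree_X_pow_sub_C] at key

end Indep
end Quartic
end SphereConf

/-! ### The form of the new points for four old points -/

namespace SphereConf

open Filter Topology
namespace Quartic

/-- The forms whose zeros are the new points. -/
def newForm (δ ε s : ℕ) (a : Fin 4 → ℂ × ℂ) (v : ℂ × ℂ) : ℂ :=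
  sextic a v ^ δ * (threeTorsion a v ^ ε * ∏ j ∈ Finset.range s, circle j a v)

section Indep
variable {a : Fin 4 → ℂ × ℂ}

lemma circle_ne_zero_of_form_eq_zero (ha : Indep a) {v : ℂ × ℂ} (hv : v ≠ 0)
    (h : form a v = 0) (j : ℕ) : circle j a v ≠ 0 := by
  simpa [circle, h] using hessian_ne_zero ha hv h

lemma threeTorsion_ne_zero_of_form_eq_zero (ha : Indep a) {v : ℂ × ℂ} (hv : v ≠ 0)
    (h : form a v = 0) : threeTorsion a v ≠ 0 := by
  simpa [threeTorsion, h] using hessian_ne_zero ha hv h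

lemma ratio_of_circle_eq_zero {j : ℕ} {v : ℂ × ℂ} (hf : form a v ≠ 0) (h : circle j a v = 0) :
    (hessian a v / form a v) ^ 6 = level j a := by
  rw [circle] at h
  field_simp
  linear_combination h

lemma ratio_of_threeTorsion_eq_zero {v : ℂ × ℂ} (hf : form a v ≠ 0) (h : threeTorsion a v = 0) :
    (hessian a v / form a v) ^ 4 + 2 * coeffA a * (hessian a v / form a v) ^ 2
      + 4 * coeffB a * (hessian a v / form a v) - coeffA a ^ 2 / 3 = 0 := by
  rw [threeTorsion] at h
  field_simp
  linear_combination 3 * h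

/-- A common zero would have its x-value H/f on two circles of different radii. -/
lemma circle_disjoint (ha : Indep a) {i j : ℕ} (hij : i ≠ j) {v : ℂ × ℂ} (hv : v ≠ 0)
    (h : circle i a v = 0) : circle j a v ≠ 0 := by
  intro h'
  have hf : form a v ≠ 0 := fun hf => circle_ne_zero_of_form_eq_zero ha hv hf i h
  have h1 := norm_of_pow_eq_level ha (ratio_of_circle_eq_zero hf h)
  have h2 := norm_of_pow_eq_level ha (ratio_of_circle_eq_zero hf h')
  have hs := size_pos ha
  rw [h1, mul_left_inj' hs.ne'] at h2
  exact hij (by exact_mod_cast (show (i : ℝ) = j by linarith))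

lemma threeTorsion_disjoint (ha : Indep a) (j : ℕ) {v : ℂ × ℂ} (hv : v ≠ 0)
    (h : threeTorsion a v = 0) : circle j a v ≠ 0 := by
  intro h'
  have hf : form a v ≠ 0 := fun hf => threeTorsion_ne_zero_of_form_eq_zero ha hv hf h
  have h1 := norm_lt_of_threeTorsion ha (ratio_of_threeTorsion_eq_zero hf h)
  rw [norm_of_pow_eq_level ha (ratio_of_circle_eq_zero hf h')] at h1
  have := mul_nonneg (Nat.cast_nonneg (α := ℝ) j) (size_pos ha).le
  linarith

lemma form_ne_zero_of_sextic (ha : Indep a) {v : ℂ × ℂ} (hv : v ≠ 0) (h : sextic a v = 0) :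
    form a v ≠ 0 := by
  intro hf
  obtain ⟨e, -, he⟩ := exists_of_sextic_eq_zero h
  exact hessian_ne_zero ha hv hf (by simp [he, hf])

lemma threeTorsion_ne_zero_of_sextic (ha : Indep a) {v : ℂ × ℂ} (hv : v ≠ 0)
    (h : sextic a v = 0) : threeTorsion a v ≠ 0 := by
  intro h'
  have hf := form_ne_zero_of_sextic ha hv h
  obtain ⟨e, he, hH⟩ := exists_of_sextic_eq_zero h
  have h1 := ne_root_of_threeTorsion ha (ratio_of_threeTorsion_eq_zero hf h')
  rw [hH, mul_div_cancel_right₀ _ hf, resolvent_eq] at h1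
  rcases he with rfl | rfl | rfl <;> simp at h1

lemma circle_ne_zero_of_sextic (ha : Indep a) {v : ℂ × ℂ} (hv : v ≠ 0)
    (h : sextic a v = 0) (j : ℕ) : circle j a v ≠ 0 := by
  intro h'
  have hf := form_ne_zero_of_sextic ha hv h
  have hs := size_pos ha
  obtain ⟨e, he, hH⟩ := exists_of_sextic_eq_zero h
  have h1 := norm_of_pow_eq_level ha (ratio_of_circle_eq_zero hf h')
  rw [hH, mul_div_cancel_right₀ _ hf] at h1
  have h2 : ‖e‖ ≤ 4 / 3 * size a := by
    rcases he with rfl | rfl | rfl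
    exacts [norm_e₁_le a, norm_e₂_le a, norm_e₃_le a]
  have := mul_nonneg (Nat.cast_nonneg (α := ℝ) j) hs.le
  linarith

lemma simpleZeros_newForm (ha : Indep a) {δ ε : ℕ} (hδ : δ ≤ 1) (hε : ε ≤ 1) (s : ℕ) :
    SimpleZeros (δ * 6 + (ε * 16 + s * 24)) (newForm δ ε s a) := by
  have hc : SimpleZeros (s * 24) (fun v => ∏ j ∈ Finset.range s, circle j a v) := by
    simpa using SimpleZeros.prod (Finset.range s) (F := fun j => circle j a)
      (fun j _ => simpleZeros_circle ha j) fun i _ j _ hij v hv h => circle_disjoint ha hij hv h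
  refine ((simpleZeros_sextic ha).pow_of_le_one hδ).mul
    (((simpleZeros_threeTorsion ha).pow_of_le_one hε).mul hc ?_) ?_
  · intro v hv h
    exact Finset.prod_ne_zero_iff.2 fun j _ =>
      threeTorsion_disjoint ha j hv (eq_zero_of_pow_eq_zero h)
  · intro v hv h
    have h := eq_zero_of_pow_eq_zero h
    exact mul_ne_zero (pow_ne_zero _ (threeTorsion_ne_zero_of_sextic ha hv h))
      (Finset.prod_ne_zero_iff.2 fun j _ => circle_ne_zero_of_sextic ha hv h j)

lemma newForm_ne_zero (ha : Indep a) (δ ε s : ℕ) (i : Fin 4) : newForm δ ε s a (a i) ≠ 0 := by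
  have hf : form a (a i) = 0 := by
    have h : br (a i) (a i) = 0 := by simp only [br]; ring
    fin_cases i <;> simp only [Fin.zero_eta, Fin.mk_one, Fin.reduceFinMk] at h <;> simp [form, h]
  have hv : a i ≠ 0 := by
    intro h
    obtain ⟨j, hj⟩ := exists_ne i
    exact ha i j hj.symm (by simp [br, h])
  refine mul_ne_zero (pow_ne_zero _ fun h => form_ne_zero_of_sextic ha hv h hf)
    (mul_ne_zero (pow_ne_zero _ (threeTorsion_ne_zero_of_form_eq_zero ha hv hf))
      (Finset.prod_ne_zero_iff.2 fun j _ => circle_ne_zero_of_form_eq_zero ha hv hf j))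

lemma continuousAt_newForm (ha : Indep a) (δ ε s : ℕ) (v : ℂ × ℂ) :
    ContinuousAt (fun a => newForm δ ε s a v) a := by
  have h1 : Continuous X₁ := by unfold X₁ br; fun_prop
  have h2 : Continuous X₂ := by unfold X₂ br; fun_prop
  have h3 : Continuous X₃ := by unfold X₃ br; fun_prop
  have k1 : Continuous fun a => q₁ a v := by unfold q₁ br; fun_prop
  have k2 : Continuous fun a => q₂ a v := by unfold q₂ br; fun_prop
  have k3 : Continuous fun a => q₃ a v := by unfold q₃ br; fun_prop
  have hf : Continuous fun a => form a v := by unfold form br; fun_prop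
  have hH : Continuous fun a => hessian a v := by unfold hessian; fun_prop
  have hT : Continuous fun a => sextic a v := by unfold sextic; fun_prop
  have hA : Continuous coeffA := by unfold coeffA e₁ e₂ e₃; fun_prop
  have hB : Continuous coeffB := by unfold coeffB e₁ e₂ e₃; fun_prop
  have hψ : Continuous fun a => threeTorsion a v := by unfold threeTorsion; fun_prop
  have hN : Continuous size := by unfold size; fun_prop
  have hD : Continuous disc := by unfold disc; fun_prop
  -- The phase of the discriminant is the only non-polynomial phase involved; it is continuous where
  -- `disc` is nonzero.
  have hl : ∀ j, ContinuousAt (level j) a := by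
    intro j
    unfold level
    refine ContinuousAt.mul ?_ (hD.continuousAt.div ?_ ?_)
    · fun_prop
    · fun_prop
    · simpa using disc_ne_zero ha
  refine (hT.continuousAt.pow δ).mul ((hψ.continuousAt.pow ε).mul ?_)
  refine tendsto_finsetProd _ fun j _ => ?_
  exact (hH.continuousAt.pow 6).sub ((hl j).mul (hf.continuousAt.pow 6))

end Indep

section Scale
variable (a : Fin 4 → ℂ × ℂ) (c : Fin 4 → ℂ)

lemma X₁_smul : X₁ (fun i => c i • a i) = (∏ i, c i) * X₁ a := by
  simp only [X₁, br_smul_left, br_smul_right, Fin.prod_univ_four]; ring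

lemma X₂_smul : X₂ (fun i => c i • a i) = (∏ i, c i) * X₂ a := by
  simp only [X₂, br_smul_left, br_smul_right, Fin.prod_univ_four]; ring

lemma X₃_smul : X₃ (fun i => c i • a i) = (∏ i, c i) * X₃ a := by
  simp only [X₃, br_smul_left, br_smul_right, Fin.prod_univ_four]; ring

lemma form_smul (v : ℂ × ℂ) : form (fun i => c i • a i) v = (∏ i, c i) * form a v := by
  simp only [form, br_smul_left, Fin.prod_univ_four]; ring

lemma q₁_smul (v : ℂ × ℂ) : q₁ (fun i => c i • a i) v = (∏ i, c i) * q₁ a v := by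
  simp only [q₁, br_smul_left, br_smul_right, Fin.prod_univ_four]; ring

lemma q₂_smul (v : ℂ × ℂ) : q₂ (fun i => c i • a i) v = (∏ i, c i) * q₂ a v := by
  simp only [q₂, br_smul_left, br_smul_right, Fin.prod_univ_four]; ring

lemma q₃_smul (v : ℂ × ℂ) : q₃ (fun i => c i • a i) v = (∏ i, c i) * q₃ a v := by
  simp only [q₃, br_smul_left, br_smul_right, Fin.prod_univ_four]; ring

lemma hessian_smul (v : ℂ × ℂ) : hessian (fun i => c i • a i) v = (∏ i, c i) ^ 2 * hessian a v := by
  simp only [hessian, q₁_smul, q₂_smul, q₃_smul]; ring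

lemma sextic_smul (v : ℂ × ℂ) : sextic (fun i => c i • a i) v = (∏ i, c i) ^ 3 * sextic a v := by
  simp only [sextic, q₁_smul, q₂_smul, q₃_smul]; ring

lemma threeTorsion_smul (v : ℂ × ℂ) :
    threeTorsion (fun i => c i • a i) v = (∏ i, c i) ^ 8 * threeTorsion a v := by
  simp only [threeTorsion, coeffA, coeffB, e₁, e₂, e₃, hessian_smul, form_smul, X₁_smul, X₂_smul,
    X₃_smul]
  ring

/-- With C = ∏ cᵢ, `size` contributes |C|⁶ and the phase of `disc` contributes (C/|C|)⁶. The product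
C⁶ is the factor by which (H/f)⁶ scales. -/
lemma level_smul (hc : ∀ i, c i ≠ 0) (j : ℕ) :
    level j (fun i => c i • a i) = (∏ i, c i) ^ 6 * level j a := by
  have hC : (‖∏ i, c i‖ : ℂ) ≠ 0 := by
    simpa only [ne_eq, Complex.ofReal_eq_zero, norm_eq_zero] using
      Finset.prod_ne_zero_iff.2 fun i _ => hc i
  simp only [level, size, disc, X₁_smul, X₂_smul, X₃_smul]
  generalize ∏ i, c i = C at *
  simp only [norm_mul, norm_pow]
  push_cast
  -- If the discriminant vanishes, both sides are 0 by the convention 0/0 = 0.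
  by_cases h : (‖X₁ a‖ : ℂ) * ‖X₂ a‖ * ‖X₃ a‖ = 0
  · have : X₁ a * X₂ a * X₃ a = 0 := by simpa using h
    rw [show C * X₁ a * (C * X₂ a) * (C * X₃ a) = C ^ 3 * (X₁ a * X₂ a * X₃ a) by ring, this]
    simp
  · simp only [mul_eq_zero, not_or] at h
    obtain ⟨⟨h1, h2⟩, h3⟩ := h
    field_simp

lemma circle_smul (hc : ∀ i, c i ≠ 0) (j : ℕ) (v : ℂ × ℂ) :
    circle j (fun i => c i • a i) v = (∏ i, c i) ^ 12 * circle j a v := by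
  simp only [circle, hessian_smul, form_smul, level_smul a c hc]; ring

lemma newForm_smul (hc : ∀ i, c i ≠ 0) (δ ε s : ℕ) (v : ℂ × ℂ) :
    newForm δ ε s (fun i => c i • a i) v
      = (∏ i, c i) ^ (3 * δ + 8 * ε + 12 * s) * newForm δ ε s a v := by
  simp only [newForm, sextic_smul, threeTorsion_smul, circle_smul a c hc,
    Finset.prod_mul_distrib, Finset.prod_const, Finset.card_range]
  ring

end Scale

/-- A function of four vectors invariant under the adjacent transpositions is symmetric. -/
lemma symmetric_of_swap {α V : Type*} {F : (Fin 4 → V) → α}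
    (h01 : ∀ a, F (a ∘ Equiv.swap 0 1) = F a) (h12 : ∀ a, F (a ∘ Equiv.swap 1 2) = F a)
    (h23 : ∀ a, F (a ∘ Equiv.swap 2 3) = F a) (σ : Equiv.Perm (Fin 4)) (a : Fin 4 → V) :
    F (a ∘ σ) = F a := by
  have hσ : σ ∈ Submonoid.closure
      (Set.range fun i : Fin 3 => Equiv.swap i.castSucc i.succ) := by
    rw [Equiv.Perm.mclosure_swap_castSucc_succ]; trivial
  induction hσ using Submonoid.closure_induction generalizing a with
  | mem σ h =>
    obtain ⟨i, rfl⟩ := h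
    fin_cases i
    exacts [h01 a, h12 a, h23 a]
  | one => rfl
  | mul σ τ _ _ hs ht => exact (ht (a ∘ σ)).trans (hs a)

/-- The data from which the new points are constructed. -/
def invariants (v : ℂ × ℂ) (a : Fin 4 → ℂ × ℂ) : ℂ × ℂ × ℂ × ℂ × ℂ × ℝ × ℂ :=
  (form a v, hessian a v, sextic a v, coeffA a, coeffB a, size a, disc a)

/-- An adjacent transposition exchanges two of the Xᵢ and changes all signs. It therefore permutes
the eᵢ without signs and preserves `size` and `disc`. -/
lemma invariants_eq {v : ℂ × ℂ} {a b : Fin 4 → ℂ × ℂ} (hf : form b v = form a v)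
    (hH : hessian b v = hessian a v) (hT : sextic b v = sextic a v)
    (h : (X₁ b = -X₂ a ∧ X₂ b = -X₁ a ∧ X₃ b = -X₃ a) ∨
      (X₁ b = -X₁ a ∧ X₂ b = -X₃ a ∧ X₃ b = -X₂ a)) : invariants v b = invariants v a := by
  simp only [invariants, hf, hH, hT, Prod.mk.injEq, true_and]
  simp only [coeffA, coeffB, e₁, e₂, e₃, size, disc]
  rcases h with ⟨h1, h2, h3⟩ | ⟨h1, h2, h3⟩ <;> simp only [h1, h2, h3, norm_neg] <;>
    refine ⟨?_, ?_, ?_, ?_⟩ <;> ring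

/-- Adjacent transpositions permute the qᵢ with an even number of sign changes, so both the sum of
squares and the product are preserved. -/
lemma invariants_perm (v : ℂ × ℂ) (σ : Equiv.Perm (Fin 4)) (a : Fin 4 → ℂ × ℂ) :
    invariants v (a ∘ σ) = invariants v a := by
  refine symmetric_of_swap (F := invariants v) ?_ ?_ ?_ σ a <;> intro a
  · have e : a ∘ Equiv.swap 0 1 = ![a 1, a 0, a 2, a 3] := by
      funext i; fin_cases i <;> rfl
    rw [e]
    have k1 : q₁ ![a 1, a 0, a 2, a 3] v = q₁ a v := by simp [q₁, br]; ring
    have k2 : q₂ ![a 1, a 0, a 2, a 3] v = -q₃ a v := by simp [q₂, q₃, br]; ring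
    have k3 : q₃ ![a 1, a 0, a 2, a 3] v = -q₂ a v := by simp [q₂, q₃, br]; ring
    refine invariants_eq ?_ ?_ ?_ (.inl ⟨?_, ?_, ?_⟩)
    · change br (a 1) v * br (a 0) v * br (a 2) v * br (a 3) v = _
      rw [form]; ring
    · simp only [hessian, k1, k2, k3]; ring
    · simp only [sextic, k1, k2, k3]; ring
    all_goals simp [X₁, X₂, X₃, br]; ring
  · have e : a ∘ Equiv.swap 1 2 = ![a 0, a 2, a 1, a 3] := by
      funext i; fin_cases i <;> rfl
    rw [e]
    have k1 : q₁ ![a 0, a 2, a 1, a 3] v = q₂ a v := by simp [q₁, q₂, br]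
    have k2 : q₂ ![a 0, a 2, a 1, a 3] v = q₁ a v := by simp [q₁, q₂, br]
    have k3 : q₃ ![a 0, a 2, a 1, a 3] v = q₃ a v := by simp [q₃, br]; ring
    refine invariants_eq ?_ ?_ ?_ (.inr ⟨?_, ?_, ?_⟩)
    · change br (a 0) v * br (a 2) v * br (a 1) v * br (a 3) v = _
      rw [form]; ring
    · simp only [hessian, k1, k2, k3]; ring
    · simp only [sextic, k1, k2, k3]; ring
    all_goals simp [X₁, X₂, X₃, br]; ring
  · have e : a ∘ Equiv.swap 2 3 = ![a 0, a 1, a 3, a 2] := by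
      funext i; fin_cases i <;> rfl
    rw [e]
    have k1 : q₁ ![a 0, a 1, a 3, a 2] v = q₁ a v := by simp [q₁, br]; ring
    have k2 : q₂ ![a 0, a 1, a 3, a 2] v = q₃ a v := by simp [q₂, q₃, br]; ring
    have k3 : q₃ ![a 0, a 1, a 3, a 2] v = q₂ a v := by simp [q₂, q₃, br]; ring
    refine invariants_eq ?_ ?_ ?_ (.inl ⟨?_, ?_, ?_⟩)
    · change br (a 0) v * br (a 1) v * br (a 3) v * br (a 2) v = _
      rw [form]; ring
    · simp only [hessian, k1, k2, k3]; ring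
    · simp only [sextic, k1, k2, k3]; ring
    all_goals simp [X₁, X₂, X₃, br]; ring

lemma newForm_perm (δ ε s : ℕ) (σ : Equiv.Perm (Fin 4)) (a : Fin 4 → ℂ × ℂ) (v : ℂ × ℂ) :
    newForm δ ε s (a ∘ σ) v = newForm δ ε s a v := by
  have h := invariants_perm v σ a
  simp only [invariants, Prod.mk.injEq] at h
  simp only [newForm, threeTorsion, circle, level, h]

theorem isFormFamily {δ ε : ℕ} (hδ : δ ≤ 1) (hε : ε ≤ 1) (s : ℕ) :
    IsFormFamily 4 (δ * 6 + (ε * 16 + s * 24)) (newForm δ ε s) where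
  continuousAt a ha v := continuousAt_newForm ha δ ε s v
  scale a _ c hc := ⟨_, pow_ne_zero _ (Finset.prod_ne_zero_iff.2 fun i _ => hc i),
    newForm_smul a c hc δ ε s⟩
  perm a _ σ := ⟨1, one_ne_zero, fun v => by rw [newForm_perm, one_mul]⟩
  simpleZeros a ha := simpleZeros_newForm ha hδ hε s
  ne_zero a ha := newForm_ne_zero ha δ ε s

theorem exists_isSection {m : ℕ} (hm : m % 24 = 0 ∨ m % 24 = 6 ∨ m % 24 = 16 ∨ m % 24 = 22) :
    ∃ S : Conf 4 CP1 → BiConf 4 m CP1, IsSection S := by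
  obtain ⟨δ, ε, s, hδ, hε, rfl⟩ : ∃ δ ε s, δ ≤ 1 ∧ ε ≤ 1 ∧ m = δ * 6 + (ε * 16 + s * 24) := by
    rcases hm with h | h | h | h
    · exact ⟨0, 0, m / 24, by omega, by omega, by omega⟩
    · exact ⟨1, 0, m / 24, by omega, by omega, by omega⟩
    · exact ⟨0, 1, m / 24, by omega, by omega, by omega⟩
    · exact ⟨1, 1, m / 24, by omega, by omega, by omega⟩
  obtain ⟨S, hS, -⟩ := (isFormFamily hδ hε s).exists_section
  exact ⟨S, hS⟩

end Quartic
end SphereConf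

/-! ### Anharmonic invariants and the forms for three old points -/

namespace SphereConf

open Filter Topology

namespace Cubic
open Quartic (X₁ X₂ X₃ plucker symmetric_of_swap)

/-- Invariants of a cross-ratio `α / β`, homogenized. -/
def hInv (α β : ℂ) : ℂ := α ^ 2 - α * β + β ^ 2
/-- An invariant of a cross-ratio `α / β`, homogenized. -/
def qInv (α β : ℂ) : ℂ := (2 * α - β) * (α - 2 * β) * (α + β)
/-- An invariant of a cross-ratio `α / β`, homogenized. -/
def eInv (α β : ℂ) : ℂ := α * β * (α - β)

/-- The form vanishing at the cross-ratios with `j`-invariant proportional to `k + 7`. -/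
def orbitInv (k : ℕ) (α β : ℂ) : ℂ := hInv α β ^ 3 - (k + 7) * eInv α β ^ 2

/-- A form in `α` and `β` invariant under the anharmonic group. -/
def anharmonic (ε δ s : ℕ) (α β : ℂ) : ℂ :=
  hInv α β ^ ε * (qInv α β ^ δ * ∏ k ∈ Finset.range s, orbitInv k α β)

/-- On the line of j = h³/e², the exceptional orbits are j = 0 (h = 0) and j = 27/4 (q = 0), and the
degenerate cross-ratios 0, 1, ∞ lie at j = ∞. -/
lemma syzygy (α β : ℂ) : qInv α β ^ 2 = 4 * hInv α β ^ 3 - 27 * eInv α β ^ 2 := by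
  simp only [hInv, qInv, eInv]; ring

/-- Eliminates e in favour of h and q, which become the two covariants of the cubic with polynomial
coefficients. -/
lemma orbitInv_eq (k : ℕ) (α β : ℂ) : orbitInv k α β
    = (1 - 4 * ((k + 7) / 27)) * hInv α β ^ 3 + (k + 7) / 27 * qInv α β ^ 2 := by
  rw [orbitInv, syzygy]; ring

/-- The chosen values of j avoid 0 and 27/4, where an orbit has fewer than six points. -/
lemma cast_add_seven_ne (k : ℕ) : (k + 7 : ℂ) ≠ 0 ∧ 27 - 4 * (k + 7 : ℂ) ≠ 0 := by
  constructor
  · exact_mod_cast (show k + 7 ≠ 0 by omega)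
  · rw [sub_ne_zero]
    exact_mod_cast (show 27 ≠ 4 * (k + 7) by omega)

lemma eq_zero_of_hInv_eInv {α β : ℂ} (h : hInv α β = 0) (h' : eInv α β = 0) : α = 0 ∧ β = 0 := by
  simp only [hInv, eInv, mul_eq_zero, sub_eq_zero] at h h'
  rcases h' with (rfl | rfl) | rfl
  · simpa using h
  · simpa using h
  · have : α ^ 2 = 0 := by linear_combination h
    simpa using this

lemma anharmonic_ne_zero {α β : ℂ} (h : hInv α β ≠ 0) (h' : eInv α β = 0) (ε δ s : ℕ) :
    anharmonic ε δ s α β ≠ 0 := by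
  refine mul_ne_zero (pow_ne_zero _ h) (mul_ne_zero (pow_ne_zero _ ?_) ?_)
  · intro h0
    have := syzygy α β
    simp [h0, h', h] at this
  · refine Finset.prod_ne_zero_iff.2 fun k _ => ?_
    simp [orbitInv, h', h]

lemma anharmonic_smul (ε δ s : ℕ) (c α β : ℂ) :
    anharmonic ε δ s (c * α) (c * β) = c ^ (ε * 2 + (δ * 3 + s * 6)) * anharmonic ε δ s α β := by
  have h1 : hInv (c * α) (c * β) = c ^ 2 * hInv α β := by simp only [hInv]; ring
  have h2 : qInv (c * α) (c * β) = c ^ 3 * qInv α β := by simp only [qInv]; ring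
  have h3 : ∀ k, orbitInv k (c * α) (c * β) = c ^ 6 * orbitInv k α β := by
    intro k; simp only [orbitInv, hInv, eInv]; ring
  simp only [anharmonic, h1, h2, h3, Finset.prod_mul_distrib, Finset.prod_const, Finset.card_range]
  ring

/-- The substitution λ ↦ 1 - λ for λ = α/β; it fixes h and q and changes the sign of e, which enters
only squared. Together with λ ↦ λ/(λ - 1), treated in `anharmonic_neg`, it generates the anharmonic
group. -/
lemma anharmonic_sub (ε δ s : ℕ) (α β : ℂ) :
    anharmonic ε δ s (α - β) (-β) = anharmonic ε δ s α β := by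
  have h1 : hInv (α - β) (-β) = hInv α β := by simp only [hInv]; ring
  have h2 : qInv (α - β) (-β) = qInv α β := by simp only [qInv]; ring
  have h3 : eInv (α - β) (-β) = -eInv α β := by simp only [eInv]; ring
  simp only [anharmonic, orbitInv, h1, h2, h3, neg_sq]

lemma anharmonic_neg (ε δ s : ℕ) (α β : ℂ) :
    anharmonic ε δ s (-α) (β - α) = anharmonic ε δ s α β := by
  have h1 : hInv (-α) (β - α) = hInv α β := by simp only [hInv]; ring
  have h2 : qInv (-α) (β - α) = qInv α β := by simp only [qInv]; ring
  have h3 : eInv (-α) (β - α) = -eInv α β := by simp only [eInv]; ring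
  simp only [anharmonic, orbitInv, h1, h2, h3, neg_sq]

section Zeros

variable {A B : ℂ × ℂ}

lemma not_both_zero (h : br A B ≠ 0) {v : ℂ × ℂ} (hv : v ≠ 0) : ¬(br A v = 0 ∧ br B v = 0) :=
  fun h' => hv (eq_zero_of_br h h'.1 h'.2)

lemma simpleZeros_sub (h : br A B ≠ 0) (κ : ℂ) : SimpleZeros 1 (fun v => br A v - κ * br B v) := by
  have e : (fun v => br A v - κ * br B v) = br (A - κ • B) := by
    funext v; simp [br]; ring
  rw [e]
  refine SimpleZeros.linear fun h0 => h ?_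
  rw [sub_eq_zero.1 h0, br_smul_left]; simp [br]; ring_nf; simp

open Polynomial

lemma simpleZeros_poly (h : br A B ≠ 0) {p : ℂ[X]} (hp : p.Monic) {n : ℕ} (hn : p.natDegree = n)
    (hsep : ∀ x, p.eval x = 0 → p.derivative.eval x ≠ 0) {F : ℂ → ℂ → ℂ}
    (hF : ∀ α β, β ≠ 0 → F α β = β ^ n * p.eval (α / β)) (hF0 : ∀ α, F α 0 = α ^ n) :
    SimpleZeros n (fun v => F (br A v) (br B v)) := by
  have := SimpleZeros.of_poly (r := 1) (α := br A) (β := br B)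
    (G := fun v => F (br A v) (br B v)) hp hsep
    (fun v hv => by rw [hn]; exact hF _ _ hv)
    (fun v hv => by simp only [hn, hv, hF0]) (fun κ _ => simpleZeros_sub h κ)
    (fun v hv hb ha => not_both_zero h hv ⟨ha, hb⟩)
  rwa [hn, mul_one] at this

lemma simpleZeros_hInv (h : br A B ≠ 0) : SimpleZeros 2 (fun v => hInv (br A v) (br B v)) := by
  refine simpleZeros_poly h (F := hInv) (n := 2) (p := X ^ 2 - X + 1) (by monicity!) (by compute_degree!) ?_ ?_ ?_
  · intro x hx hx'
    simp at hx hx'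
    have : (3 : ℂ) = 0 := by linear_combination 4 * hx - (2 * x - 1) * hx'
    norm_num at this
  · intro α β hβ
    simp [hInv]; field_simp
  · intro α; simp [hInv]

lemma simpleZeros_qInv (h : br A B ≠ 0) : SimpleZeros 3 (fun v => qInv (br A v) (br B v)) := by
  -- Halving makes the polynomial monic.
  have key : SimpleZeros 3 (fun v => (fun α β => qInv α β / 2) (br A v) (br B v)) := by
    refine simpleZeros_poly h (F := fun α β => qInv α β / 2) (n := 3)
      (p := X ^ 3 - C (3 / 2) * X ^ 2 - C (3 / 2) * X + 1) (by monicity!) (by compute_degree!) ?_ ?_ ?_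
    · intro x hx hx'
      simp at hx hx'
      have hx : (2 * x - 1) * (x - 2) * (x + 1) = 0 := by linear_combination 2 * hx
      simp only [mul_eq_zero] at hx
      rcases hx with (hx | hx) | hx
      · obtain rfl : x = 1 / 2 := by linear_combination hx / 2
        norm_num at hx'
      · obtain rfl : x = 2 := by linear_combination hx
        norm_num at hx'
      · obtain rfl : x = -1 := by linear_combination hx
        norm_num at hx'
    · intro α β hβ
      simp [qInv]; field_simp; ring
    · intro α; simp [qInv]; ring
  have := key.const_mul (c := 2) two_ne_zero
  simpa [mul_div_cancel₀] using this

lemma simpleZeros_orbitInv (h : br A B ≠ 0) (k : ℕ) :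
    SimpleZeros 6 (fun v => orbitInv k (br A v) (br B v)) := by
  obtain ⟨hk0, hk1⟩ := cast_add_seven_ne k
  refine simpleZeros_poly h (F := orbitInv k) (n := 6)
    (p := (X ^ 2 - X + 1) ^ 3 - C (k + 7 : ℂ) * (X ^ 2 - X) ^ 2) (by monicity!)
      (by compute_degree!) ?_ ?_ ?_
  · generalize (k + 7 : ℂ) = J at *
    intro x hx hx'
    simp [derivative_pow] at hx hx'
    -- With u = x² - x, the polynomial is (u + 1)³ - Ju². A multiple root has x = 1/2, u = -1 or u =
    -- 2, which forces J = 0 or 4J = 27.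
    have hx'' : (2 * x - 1) * (3 * (x ^ 2 - x + 1) ^ 2 - 2 * J * (x ^ 2 - x)) = 0 := by
      linear_combination hx'
    rcases mul_eq_zero.1 hx'' with h1 | h1
    · obtain rfl : x = 1 / 2 := by linear_combination h1 / 2
      exact hk1 (by linear_combination 64 * hx)
    · have h2 : (x ^ 2 - x + 1) ^ 2 * (x ^ 2 - x - 2) = 0 := by
        linear_combination (x ^ 2 - x) * h1 - 2 * hx
      rcases mul_eq_zero.1 h2 with h3 | h3
      · have h3 : x ^ 2 - x = -1 := by linear_combination pow_eq_zero_iff two_ne_zero |>.1 h3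
        rw [h3] at hx
        exact hk0 (by linear_combination -hx)
      · have h3 : x ^ 2 - x = 2 := by linear_combination h3
        rw [h3] at hx
        exact hk1 (by linear_combination hx)
  · intro α β hβ
    simp [orbitInv, hInv, eInv]; field_simp
  · intro α; simp [orbitInv, hInv, eInv]; ring

lemma simpleZeros_anharmonic (h : br A B ≠ 0) {ε δ : ℕ} (hε : ε ≤ 1) (hδ : δ ≤ 1) (s : ℕ) :
    SimpleZeros (ε * 2 + (δ * 3 + s * 6)) (fun v => anharmonic ε δ s (br A v) (br B v)) := by
  have hs : SimpleZeros (s * 6) (fun v => ∏ k ∈ Finset.range s, orbitInv k (br A v) (br B v)) := by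
    simpa using SimpleZeros.prod (Finset.range s)
      (F := fun k v => orbitInv k (br A v) (br B v)) (fun k _ => simpleZeros_orbitInv h k) (by
        intro i _ j _ hij v hv h1 h2
        refine not_both_zero h hv ?_
        have hij' : (i - j : ℂ) ≠ 0 := sub_ne_zero.2 (by exact_mod_cast hij)
        have he : eInv (br A v) (br B v) = 0 := by
          refine pow_eq_zero_iff two_ne_zero |>.1 ((mul_eq_zero.1 ?_).resolve_left hij')
          simp only [orbitInv] at h1 h2
          linear_combination h2 - h1
        exact eq_zero_of_hInv_eInv (by simpa [orbitInv, he] using h1) he)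
  refine ((simpleZeros_hInv h).pow_of_le_one hε).mul
    (((simpleZeros_qInv h).pow_of_le_one hδ).mul hs ?_) ?_
  · intro v hv h1
    have h1 := eq_zero_of_pow_eq_zero h1
    refine Finset.prod_ne_zero_iff.2 fun k _ h2 => not_both_zero h hv ?_
    have hsy := syzygy (br A v) (br B v)
    rw [h1] at hsy
    have he : eInv (br A v) (br B v) = 0 := by
      refine pow_eq_zero_iff two_ne_zero |>.1
        ((mul_eq_zero.1 ?_).resolve_left (cast_add_seven_ne k).2)
      simp only [orbitInv] at h2
      linear_combination 4 * h2 + hsy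
    exact eq_zero_of_hInv_eInv (by simpa [orbitInv, he] using h2) he
  · intro v hv h1
    have h1 := eq_zero_of_pow_eq_zero h1
    have he : ∀ {c : ℂ}, c ≠ 0 → c * eInv (br A v) (br B v) ^ 2 = 0 → False := fun hc h2 =>
      not_both_zero h hv (eq_zero_of_hInv_eInv h1
        (pow_eq_zero_iff two_ne_zero |>.1 ((mul_eq_zero.1 h2).resolve_left hc)))
    refine mul_ne_zero (pow_ne_zero _ fun h2 => ?_) (Finset.prod_ne_zero_iff.2 fun k _ h2 => ?_)
    · have hsy := syzygy (br A v) (br B v)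
      rw [h1, h2] at hsy
      exact he (c := 27) (by norm_num) (by linear_combination hsy)
    · rw [orbitInv, h1] at h2
      exact he (cast_add_seven_ne k).1 (by linear_combination -h2)

end Zeros

/-- The form of four vectors vanishing if their cross-ratio is one of the chosen ones. -/
def crossForm (ε δ s : ℕ) (b : Fin 4 → ℂ × ℂ) : ℂ := anharmonic ε δ s (X₁ b) (-X₃ b)

/-- The transpositions (0 1) and (2 3) both act on the cross-ratio by λ ↦ 1 - λ, and (1 2) acts by λ
↦ λ/(λ - 1). -/
lemma crossForm_perm (ε δ s : ℕ) (σ : Equiv.Perm (Fin 4)) (b : Fin 4 → ℂ × ℂ) :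
    crossForm ε δ s (b ∘ σ) = crossForm ε δ s b := by
  refine symmetric_of_swap ?_ ?_ ?_ σ b <;> intro b <;> have hp := plucker b
  · have h1 : X₁ (b ∘ Equiv.swap 0 1) = X₁ b - -X₃ b := by
      trans -X₂ b
      · change br (b 0) (b 2) * br (b 1) (b 3) = _
        simp only [X₂, br]; ring
      · linear_combination -hp
    have h3 : X₃ (b ∘ Equiv.swap 0 1) = -X₃ b := by
      change br (b 1) (b 0) * br (b 2) (b 3) = _
      simp only [X₃, br]; ring
    rw [crossForm, h1, h3, anharmonic_sub, crossForm]
  · have h1 : X₁ (b ∘ Equiv.swap 1 2) = -X₁ b := by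
      change br (b 2) (b 1) * br (b 0) (b 3) = _
      simp only [X₁, br]; ring
    have h3 : -X₃ (b ∘ Equiv.swap 1 2) = -X₃ b - X₁ b := by
      trans X₂ b
      · change -(br (b 0) (b 2) * br (b 1) (b 3)) = _
        simp only [X₂, br]; ring
      · linear_combination hp
    rw [crossForm, h1, h3, anharmonic_neg, crossForm]
  · have h1 : X₁ (b ∘ Equiv.swap 2 3) = X₁ b - -X₃ b := by
      trans -X₂ b
      · change br (b 1) (b 3) * br (b 0) (b 2) = _
        simp only [X₂, br]; ring
      · linear_combination -hp
    have h3 : X₃ (b ∘ Equiv.swap 2 3) = -X₃ b := by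
      change br (b 0) (b 1) * br (b 3) (b 2) = _
      simp only [X₃, br]; ring
    rw [crossForm, h1, h3, anharmonic_sub, crossForm]

/-- The form whose zeros are the new points. -/
def newForm (ε δ s : ℕ) (a : Fin 3 → ℂ × ℂ) (v : ℂ × ℂ) : ℂ :=
  crossForm ε δ s ![a 0, a 1, a 2, v]

lemma newForm_eq (ε δ s : ℕ) (a : Fin 3 → ℂ × ℂ) (v : ℂ × ℂ) :
    newForm ε δ s a v
      = anharmonic ε δ s (br (a 1) (a 2) * br (a 0) v) (-(br (a 0) (a 1) * br (a 2) v)) := rfl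

lemma newForm_perm (ε δ s : ℕ) (σ : Equiv.Perm (Fin 3)) (a : Fin 3 → ℂ × ℂ) (v : ℂ × ℂ) :
    newForm ε δ s (a ∘ σ) v = newForm ε δ s a v := by
  have hσ : σ ∈ Submonoid.closure
      (Set.range fun i : Fin 2 => Equiv.swap i.castSucc i.succ) := by
    rw [Equiv.Perm.mclosure_swap_castSucc_succ]; trivial
  induction hσ using Submonoid.closure_induction generalizing a with
  | mem σ h =>
    obtain ⟨i, rfl⟩ := h
    fin_cases i
    · refine Eq.trans ?_ (crossForm_perm ε δ s (Equiv.swap 0 1) ![a 0, a 1, a 2, v])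
      refine congrArg (crossForm ε δ s) (funext fun i => ?_)
      fin_cases i <;> rfl
    · refine Eq.trans ?_ (crossForm_perm ε δ s (Equiv.swap 1 2) ![a 0, a 1, a 2, v])
      refine congrArg (crossForm ε δ s) (funext fun i => ?_)
      fin_cases i <;> rfl
  | one => rfl
  | mul σ τ _ _ hs ht => exact (ht (a ∘ σ)).trans (hs a)

/-- At the three old points the cross-ratio is 0, 1 and ∞, where e vanishes and h does not. -/
lemma newForm_ne_zero {a : Fin 3 → ℂ × ℂ} (ha : Indep a) (ε δ s : ℕ) (i : Fin 3) :
    newForm ε δ s a (a i) ≠ 0 := by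
  have h01 := ha 0 1 (by decide)
  have h12 := ha 1 2 (by decide)
  have h02 := ha 0 2 (by decide)
  have h20 := ha 2 0 (by decide)
  have h21 := ha 2 1 (by decide)
  have hself : ∀ b : ℂ × ℂ, br b b = 0 := fun b => by simp only [br]; ring
  rw [newForm_eq]
  fin_cases i
  · apply anharmonic_ne_zero <;> simp [hInv, eInv, hself, h01, h20]
  · have : -(br (a 0) (a 1) * br (a 2) (a 1)) = br (a 1) (a 2) * br (a 0) (a 1) := by
      simp only [br]; ring
    apply anharmonic_ne_zero
    · simp [hInv, this, ← sq, h12, h01]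
    · simp [eInv, this]
  · apply anharmonic_ne_zero <;> simp [hInv, eInv, hself, h12, h02]

theorem isFormFamily {ε δ : ℕ} (hε : ε ≤ 1) (hδ : δ ≤ 1) (s : ℕ) :
    IsFormFamily 3 (ε * 2 + (δ * 3 + s * 6)) (newForm ε δ s) where
  continuousAt a _ v := by
    refine Continuous.continuousAt ?_
    simp only [newForm_eq, anharmonic, orbitInv, hInv, qInv, eInv, br]
    fun_prop
  scale a _ c hc := by
    refine ⟨(∏ i, c i) ^ (ε * 2 + (δ * 3 + s * 6)),
      pow_ne_zero _ (Finset.prod_ne_zero_iff.2 fun i _ => hc i), fun v => ?_⟩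
    rw [newForm_eq, newForm_eq, ← anharmonic_smul]
    simp only [br_smul_left, br_smul_right, Fin.prod_univ_three]
    congr 1 <;> ring
  perm a _ σ := ⟨1, one_ne_zero, fun v => by rw [newForm_perm, one_mul]⟩
  simpleZeros a ha := by
    have h : br (br (a 1) (a 2) • a 0) (-br (a 0) (a 1) • a 2) ≠ 0 := by
      rw [br_smul_left, br_smul_right]
      exact mul_ne_zero (ha _ _ (by decide)) (mul_ne_zero (neg_ne_zero.2 (ha _ _ (by decide)))
        (ha _ _ (by decide)))
    convert simpleZeros_anharmonic h hε hδ s using 3 with v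
    rw [newForm_eq, br_smul_left, br_smul_left, neg_mul]
  ne_zero a ha := newForm_ne_zero ha ε δ s

end Cubic
end SphereConf

/-! ### Möbius action and cross-ratios -/

namespace SphereConf

open Filter Topology

/-- The linear action of `GL₂(ℂ)` on homogeneous coordinates. -/
def act (g : GL (Fin 2) ℂ) (v : ℂ × ℂ) : ℂ × ℂ :=
  (g 0 0 * v.1 + g 0 1 * v.2, g 1 0 * v.1 + g 1 1 * v.2)

lemma isLift_coe {x y : ℂ} (hy : y ≠ 0) : IsLift ((x / y : ℂ) : CP1) (x, y) :=
  ⟨-y, neg_ne_zero.2 hy, by simp; field_simp⟩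

lemma isLift_infty {x : ℂ} (hx : x ≠ 0) : IsLift OnePoint.infty (x, 0) :=
  ⟨x, hx, by simp⟩

lemma IsLift.act {p : CP1} {v : ℂ × ℂ} (h : IsLift p v) (g : GL (Fin 2) ℂ) :
    IsLift (g • p) (act g v) := by
  have hdet : g 0 0 * g 1 1 - g 0 1 * g 1 0 ≠ 0 := by
    have := g.det_ne_zero
    rwa [Matrix.det_fin_two] at this
  obtain ⟨c, hc, rfl⟩ := h
  have hlin : SphereConf.act g (c • SphereConf.rep p)
      = c • SphereConf.act g (SphereConf.rep p) := by
    ext <;> simp [SphereConf.act] <;> ring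
  suffices IsLift (g • p) (SphereConf.act g (SphereConf.rep p)) by
    obtain ⟨d, hd, h⟩ := this
    exact ⟨c * d, mul_ne_zero hc hd, by rw [hlin, h, mul_smul]⟩
  induction p using OnePoint.rec with
  | infty =>
    rw [OnePoint.smul_infty_eq_ite]
    split_ifs with h
    · have h0 : g 0 0 ≠ 0 := by
        intro h0; simp [h, h0] at hdet
      simpa [SphereConf.act, h] using isLift_infty h0
    · simpa [SphereConf.act] using isLift_coe (x := g 0 0) h
  | coe a =>
    rw [OnePoint.smul_some_eq_ite]
    have e : SphereConf.act g (SphereConf.rep (a : CP1))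
        = (-(g 0 0 * a + g 0 1), -(g 1 0 * a + g 1 1)) := by
      ext <;> simp [SphereConf.act] <;> ring
    rw [e]
    split_ifs with h
    · rw [h, neg_zero]
      refine isLift_infty (neg_ne_zero.2 fun h0 => hdet ?_)
      by_cases h1 : g 1 0 = 0
      · have h2 : g 1 1 = 0 := by simpa [h1] using h
        simp [h1, h2]
      · apply (mul_eq_zero.1 _).resolve_left (show (1 : ℂ) ≠ 0 by norm_num)
        linear_combination g 0 0 * h - g 1 0 * h0
    · rw [← neg_div_neg_eq]
      exact isLift_coe (neg_ne_zero.2 h)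

lemma br_act (g : GL (Fin 2) ℂ) (a b : ℂ × ℂ) :
    br (act g a) (act g b) = (g 0 0 * g 1 1 - g 0 1 * g 1 0) * br a b := by
  simp only [br, act]; ring

section CrossRatio
open Quartic (X₁ X₃ X₁_smul X₃_smul X₁_ne_zero X₃_ne_zero)

/-- The cross-ratio is X₁/(-X₃): a matrix multiplies every bracket by its determinant, so the ratio
can be computed at (0, 1, ∞, l). -/
lemma hasCrossRatio_iff {z : PConf (Fin 4) CP1} {l : ℂ} :
    HasCrossRatio z l ↔ X₁ (rep ∘ z.1) = l * -X₃ (rep ∘ z.1) := by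
  have hz := indep_rep z
  constructor
  · rintro ⟨g, h0, h1, h2, h3⟩
    have hdet : g 0 0 * g 1 1 - g 0 1 * g 1 0 ≠ 0 := by
      have := g.det_ne_zero
      rwa [Matrix.det_fin_two] at this
    have hl : ∀ i, IsLift (g • z.1 i) (act g (rep (z.1 i))) := fun i => (IsLift.rep _).act g
    choose c hc h using hl
    have e : (fun i => act g (rep (z.1 i)))
        = fun i => c i • (![rep ((0 : ℂ) : CP1), rep ((1 : ℂ) : CP1), rep OnePoint.infty,
          rep (l : CP1)] : Fin 4 → ℂ × ℂ) i := by
      funext i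
      rw [h]
      fin_cases i <;> simp [h0, h1, h2, h3]
    have k1 := congrArg X₁ e
    have k3 := congrArg X₃ e
    rw [X₁_smul] at k1
    rw [X₃_smul] at k3
    simp only [X₁, X₃, br_act] at k1 k3
    simp [br] at k1 k3
    apply mul_left_cancel₀ (pow_ne_zero 2 hdet)
    simp only [X₁, X₃, Function.comp_apply, br]
    linear_combination k1 + l * k3
  · intro h
    set b := rep ∘ z.1 with hb
    have h01 := hz 0 1 (by decide)
    have h12 := hz 1 2 (by decide)
    have h02 := hz 0 2 (by decide)
    have h3 := X₃_ne_zero hz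
    -- The rows are the linear forms whose values at b 3 are X₁ and -X₃; their quotient sends the
    -- first three points to 0, 1, ∞.
    have hdet : (!![-(br (b 1) (b 2) * (b 0).2), br (b 1) (b 2) * (b 0).1;
        br (b 0) (b 1) * (b 2).2, -(br (b 0) (b 1) * (b 2).1)] : Matrix (Fin 2) (Fin 2) ℂ).det
        ≠ 0 := by
      rw [Matrix.det_fin_two_of]
      convert mul_ne_zero (mul_ne_zero h12 h01) (neg_ne_zero.2 h02) using 1
      simp only [br]; ring
    let g := Matrix.GeneralLinearGroup.mkOfDetNeZero _ hdet
    have hact : ∀ v, act g v = (br (b 1) (b 2) * br (b 0) v, -(br (b 0) (b 1) * br (b 2) v)) := by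
      intro v
      simp only [act, g, Matrix.GeneralLinearGroup.mkOfDetNeZero]
      ext
      · simp [br]; ring
      · simp [br]; ring
    have key : ∀ i, IsLift (g • z.1 i)
        (br (b 1) (b 2) * br (b 0) (b i), -(br (b 0) (b 1) * br (b 2) (b i))) := by
      intro i
      rw [← hact]
      exact (IsLift.rep _).act g
    have hself : ∀ b : ℂ × ℂ, br b b = 0 := fun b => by simp only [br]; ring
    refine ⟨g, (key 0).eq ?_, (key 1).eq ?_, (key 2).eq ?_, (key 3).eq ?_⟩
    · have := isLift_coe (x := 0) (y := -(br (b 0) (b 1) * br (b 2) (b 0)))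
        (neg_ne_zero.2 (mul_ne_zero h01 (hz 2 0 (by decide))))
      simpa [hself] using this
    · have e : -(br (b 0) (b 1) * br (b 2) (b 1)) = br (b 1) (b 2) * br (b 0) (b 1) := by
        simp only [br]; ring
      rw [e]
      have hne := mul_ne_zero h12 h01
      have := isLift_coe (x := br (b 1) (b 2) * br (b 0) (b 1)) hne
      rwa [div_self hne] at this
    · rw [hself, mul_zero, neg_zero]
      exact isLift_infty (mul_ne_zero h12 h02)
    · have := isLift_coe (x := X₁ b) (neg_ne_zero.2 h3)
      rw [(div_eq_iff (neg_ne_zero.2 h3)).2 h] at this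
      exact this

end CrossRatio

section Action

variable {G X : Type} [Group G] [MulAction G X] {n m : ℕ}

lemma oldPoints_smul (g : G) (b : BiConf n m X) : oldPoints (g • b) = g • oldPoints b := by
  induction b using Quotient.inductionOn with | h z => rfl

lemma newPoints_smul (g : G) (b : BiConf n m X) : newPoints (g • b) = g • newPoints b := by
  induction b using Quotient.inductionOn with | h z => rfl

lemma Conf.points_smul (g : G) (c : Conf n X) : (g • c).points = (g • ·) '' c.points := by
  induction c using Quotient.inductionOn with | h z => exact Set.range_comp (g • ·) z.1

end Action

lemma smul_mem_crossRatioOrbit {c : Conf 3 CP1} {l : ℂ} {p : CP1} (g : GL (Fin 2) ℂ)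
    (h : p ∈ crossRatioOrbit c l) : g • p ∈ crossRatioOrbit (g • c) l := by
  obtain ⟨z, hz, g', h0, h1, h2, h3⟩ := h
  refine ⟨⟨fun i => g • z.1 i, (MulAction.injective g).comp z.2⟩, ?_, g' * g⁻¹, ?_, ?_, ?_, ?_⟩
  · rw [Conf.points_smul, ← Set.image_insert_eq, ← hz]
    exact Set.range_comp (g • ·) z.1
  all_goals simpa [mul_smul]

lemma smul_crossRatioOrbit (c : Conf 3 CP1) (l : ℂ) (g : GL (Fin 2) ℂ) :
    crossRatioOrbit (g • c) l = (g • ·) '' crossRatioOrbit c l := by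
  ext p
  constructor
  · intro h
    refine ⟨g⁻¹ • p, ?_, smul_inv_smul g p⟩
    have := smul_mem_crossRatioOrbit g⁻¹ h
    have e : g⁻¹ • g • c = c := by
      refine Conf.ext_points ?_
      rw [Conf.points_smul, Conf.points_smul, Set.image_image]
      simp
    rwa [e] at this
  · rintro ⟨q, hq, rfl⟩
    exact smul_mem_crossRatioOrbit g hq

namespace Cubic
open Polynomial
open Quartic (X₁ X₃ X₃_ne_zero)

/-- The anharmonic form as a polynomial in the cross-ratio. -/
def anharmonicPoly (ε δ s : ℕ) : ℂ[X] :=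
  (X ^ 2 - X + 1) ^ ε * (((2 * X - 1) * (X - 2) * (X + 1)) ^ δ *
    ∏ k ∈ Finset.range s, ((X ^ 2 - X + 1) ^ 3 - C (k + 7 : ℂ) * (X * (X - 1)) ^ 2))

lemma eval_anharmonicPoly (ε δ s : ℕ) (l : ℂ) :
    (anharmonicPoly ε δ s).eval l = anharmonic ε δ s l 1 := by
  simp [anharmonicPoly, anharmonic, orbitInv, hInv, qInv, eInv, eval_prod]

/-- The cross-ratios at which the anharmonic form vanishes. -/
def crossRatios (ε δ s : ℕ) : Finset ℂ := (anharmonicPoly ε δ s).roots.toFinset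

lemma mem_crossRatios {ε δ s : ℕ} {l : ℂ} :
    l ∈ crossRatios ε δ s ↔ anharmonic ε δ s l 1 = 0 := by
  have h : anharmonicPoly ε δ s ≠ 0 := by
    intro h
    have h0 := eval_anharmonicPoly ε δ s 0
    rw [h, eval_zero] at h0
    exact anharmonic_ne_zero (by simp [hInv]) (by simp [eInv]) ε δ s h0.symm
  rw [crossRatios, Multiset.mem_toFinset, mem_roots h, IsRoot.def, eval_anharmonicPoly]

lemma crossForm_eq_zero_iff {b : Fin 4 → ℂ × ℂ} (hb : Indep b) (ε δ s : ℕ) :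
    crossForm ε δ s b = 0 ↔ X₁ b / -X₃ b ∈ crossRatios ε δ s := by
  have h3 := neg_ne_zero.2 (X₃_ne_zero hb)
  rw [mem_crossRatios, crossForm]
  have := anharmonic_smul ε δ s (-X₃ b) (X₁ b / -X₃ b) 1
  rw [mul_one, mul_div_cancel₀ _ h3] at this
  rw [this, mul_eq_zero, or_iff_right (pow_ne_zero _ h3)]

lemma injective_cons_four {z : PConf (Fin 3) CP1} {p : CP1} (h : ∀ i, z.1 i ≠ p) :
    Function.Injective ![z.1 0, z.1 1, z.1 2, p] := by
  intro i j hij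
  fin_cases i <;> fin_cases j <;> simp_all [z.2.eq_iff, eq_comm]

lemma mem_iUnion_crossRatioOrbit (ε δ s : ℕ) (z : PConf (Fin 3) CP1) (p : CP1) :
    p ∈ ⋃ l ∈ crossRatios ε δ s, crossRatioOrbit (Quotient.mk _ z) l ↔
      newForm ε δ s (rep ∘ z.1) (rep p) = 0 := by
  have hrange : Set.range ![z.1 0, z.1 1, z.1 2, p] = insert p (Set.range z.1) := by
    ext q
    simp only [Set.mem_range, Set.mem_insert_iff, Fin.exists_fin_succ, Matrix.cons_val_zero]
    simp [eq_comm]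
    tauto
  have hw : ∀ w : PConf (Fin 4) CP1, w.1 = ![z.1 0, z.1 1, z.1 2, p] →
      crossForm ε δ s (rep ∘ w.1) = newForm ε δ s (rep ∘ z.1) (rep p) := by
    intro w hw
    rw [newForm, hw]
    congr 1
    funext i
    fin_cases i <;> rfl
  simp only [Set.mem_iUnion, exists_prop]
  constructor
  · rintro ⟨l, hl, w, hwr, hwl⟩
    replace hwr : Set.range w.1 = insert p (Set.range z.1) := hwr
    -- Four distinct points cannot have a three-element range.
    have hp : p ∉ Set.range z.1 := by
      intro hp
      rw [Set.insert_eq_of_mem hp] at hwr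
      have := congrArg Set.ncard hwr
      rw [← Set.image_univ, ← Set.image_univ, Set.ncard_image_of_injective _ w.2,
        Set.ncard_image_of_injective _ z.2] at this
      simp at this
    have hinj := injective_cons_four fun i h => hp ⟨i, h⟩
    obtain ⟨σ, hσ⟩ := exists_perm_of_range_eq hinj w.2 (by rw [hrange, hwr])
    rw [← hw ⟨_, hinj⟩ rfl, ← crossForm_perm ε δ s σ, Function.comp_assoc, ← hσ,
      crossForm_eq_zero_iff (indep_rep w)]
    rw [hasCrossRatio_iff, ← div_eq_iff (neg_ne_zero.2 (X₃_ne_zero (indep_rep w)))] at hwl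
    rwa [hwl]
  · intro h
    have h0 : ∀ i, z.1 i ≠ p := by
      rintro i rfl
      exact newForm_ne_zero (indep_rep z) ε δ s i h
    have hinj := injective_cons_four h0
    have hwi := indep_rep ⟨_, hinj⟩
    rw [← hw ⟨_, hinj⟩ rfl, crossForm_eq_zero_iff hwi] at h
    refine ⟨_, h, ⟨_, hinj⟩, hrange, ?_⟩
    rw [hasCrossRatio_iff, div_mul_cancel₀ _ (neg_ne_zero.2 (X₃_ne_zero hwi))]

end Cubic

end SphereConf

/-! ### Algebraicity and equivariance for three points -/

namespace SphereConf

open Filter Topology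

lemma pointForm_eq (p : CP1) :
    pointForm p = Polynomial.C (rep p).1 - Polynomial.C (rep p).2 * Polynomial.X := by
  induction p using OnePoint.rec with
  | infty => simp [pointForm]
  | coe a =>
    simp only [pointForm, OnePoint.elim_some, rep_coe, map_neg, map_one]
    ring

/-- The signs in `rep` are chosen to make this an equality without a scalar factor. -/
lemma eval_pointForm (p : CP1) (x : ℂ) : (pointForm p).eval x = br (rep p) (x, 1) := by
  simp [pointForm_eq, br]

lemma pointForm_ne_zero (p : CP1) : pointForm p ≠ 0 := by
  induction p using OnePoint.rec with
  | infty => exact one_ne_zero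
  | coe a => exact Polynomial.X_sub_C_ne_zero a

lemma natDegree_pointForm_le (p : CP1) : (pointForm p).natDegree ≤ 1 := by
  rw [pointForm_eq]; compute_degree

lemma Conf.coords_ne_zero {n : ℕ} (c : Conf n CP1) : ∃ j, c.coords j ≠ 0 := by
  induction c using Quotient.inductionOn with | h z =>
  set P := ∏ i, pointForm (z.1 i) with hP
  have h0 : P ≠ 0 := Finset.prod_ne_zero_iff.2 fun i _ => pointForm_ne_zero _
  have hdeg : P.natDegree ≤ n := by
    refine (Polynomial.natDegree_prod_le _ _).trans ?_
    refine (Finset.sum_le_sum fun i _ => natDegree_pointForm_le (z.1 i)).trans ?_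
    simp
  exact ⟨⟨P.natDegree, by omega⟩, Polynomial.leadingCoeff_ne_zero.2 h0⟩

lemma isRegularMap_id {n : ℕ} : IsRegularMap (fun c : Conf n CP1 => c) := fun c₀ =>
  ⟨1, fun j => MvPolynomial.X j, fun j => MvPolynomial.isHomogeneous_X ℂ j, by
    simpa using c₀.coords_ne_zero, fun c _ => ⟨1, one_ne_zero, fun j => by simp⟩⟩

/-- All coefficients are homogeneous of degree `d`. -/
def HomCoeff {σ : Type*} (d : ℕ) (P : (MvPolynomial σ ℂ)[X]) : Prop :=
  ∀ j, (P.coeff j).IsHomogeneous d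

namespace HomCoeff

variable {σ : Type*} {d e : ℕ} {P Q : (MvPolynomial σ ℂ)[X]}

lemma add (hP : HomCoeff d P) (hQ : HomCoeff d Q) : HomCoeff d (P + Q) := fun j => by
  rw [Polynomial.coeff_add]; exact (hP j).add (hQ j)

lemma mul (hP : HomCoeff d P) (hQ : HomCoeff e Q) : HomCoeff (d + e) (P * Q) := fun j => by
  rw [Polynomial.coeff_mul]
  exact MvPolynomial.IsHomogeneous.sum _ _ _ fun x _ => (hP x.1).mul (hQ x.2)

lemma monomial {a : MvPolynomial σ ℂ} (ha : a.IsHomogeneous d) (k : ℕ) :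
    HomCoeff d (Polynomial.C a * Polynomial.X ^ k) := fun j => by
  rw [Polynomial.coeff_C_mul_X_pow]
  split_ifs
  · exact ha
  · exact MvPolynomial.isHomogeneous_zero _ _ _

lemma const {a : MvPolynomial σ ℂ} (ha : a.IsHomogeneous d) : HomCoeff d (Polynomial.C a) := by
  simpa using monomial ha 0

lemma one : HomCoeff 0 (1 : (MvPolynomial σ ℂ)[X]) := by
  simpa using const (MvPolynomial.isHomogeneous_one σ ℂ)

lemma pow (hP : HomCoeff d P) (k : ℕ) : HomCoeff (k * d) (P ^ k) := by
  induction k with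
  | zero => simpa using one
  | succ k ih => rw [pow_succ, add_mul, one_mul]; exact ih.mul hP

lemma const_mul (c : ℂ) (hP : HomCoeff d P) :
    HomCoeff d (Polynomial.C (MvPolynomial.C c) * P) := by
  simpa using (const (MvPolynomial.isHomogeneous_C σ c)).mul hP

lemma prod {ι : Type*} (s : Finset ι) {F : ι → (MvPolynomial σ ℂ)[X]}
    (h : ∀ i ∈ s, HomCoeff d (F i)) : HomCoeff (s.card * d) (∏ i ∈ s, F i) := by
  classical
  induction s using Finset.induction_on with
  | empty => simpa using one
  | insert i s hi ih =>
    rw [Finset.prod_insert hi, Finset.card_insert_of_notMem hi, add_mul, one_mul, add_comm]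
    exact (h i (by simp)).mul (ih fun j hj => h j (by simp [hj]))

end HomCoeff

/-- A family of forms with coefficients polynomial in the coordinates of the configuration gives
an algebraic section. -/
lemma isRegularMap_of_homCoeff {n m d : ℕ} {G : (Fin n → ℂ × ℂ) → ℂ × ℂ → ℂ}
    {f : Conf n CP1 → Conf m CP1}
    (hf : ∀ z : PConf (Fin n) CP1, ∃ p : PConf (Fin m) CP1,
      f (Quotient.mk _ z) = Quotient.mk _ p ∧
        HasZeros (G (rep ∘ z.1)) (Finset.univ.map ⟨p.1, p.2⟩))
    {P : (MvPolynomial (Fin (n + 1)) ℂ)[X]} (hP : HomCoeff d P)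
    (hPG : ∀ (z : PConf (Fin n) CP1) (x : ℂ),
      (P.map (MvPolynomial.eval (Conf.coords (Quotient.mk _ z)))).eval x
        = G (rep ∘ z.1) (x, 1)) : IsRegularMap f := by
  have key : ∀ c : Conf n CP1, ∃ u : ℂ, u ≠ 0 ∧
      ∀ j : ℕ, ∀ hj : j < m + 1, MvPolynomial.eval c.coords (P.coeff j)
        = u * (f c).coords ⟨j, hj⟩ := by
    intro c
    induction c using Quotient.inductionOn with | h z =>
    obtain ⟨p, hp, u, hu, h⟩ := hf z
    refine ⟨u, hu, fun j hj => ?_⟩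
    have hpoly : P.map (MvPolynomial.eval (Conf.coords (Quotient.mk _ z)))
        = Polynomial.C u * ∏ i, pointForm (p.1 i) := by
      refine Polynomial.funext fun x => ?_
      rw [hPG, h, Finset.prod_map, Polynomial.eval_mul, Polynomial.eval_C, Polynomial.eval_prod]
      simp only [eval_pointForm, Function.Embedding.coeFn_mk]
    have := congrArg (fun q => Polynomial.coeff q j) hpoly
    simp only [Polynomial.coeff_map, Polynomial.coeff_C_mul] at this
    rw [hp]
    exact this
  intro c₀
  -- The same polynomials serve near every point: they are a nonzero multiple of the coordinates of
  -- the image, which never all vanish.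
  refine ⟨d, fun j => P.coeff j, fun j => hP j, ?_, fun c _ => ?_⟩
  · obtain ⟨u, hu, h⟩ := key c₀
    obtain ⟨j, hj⟩ := (f c₀).coords_ne_zero
    exact ⟨j, by rw [h j j.2]; exact mul_ne_zero hu hj⟩
  · obtain ⟨u, hu, h⟩ := key c
    exact ⟨u, hu, fun j => h j j.2⟩

namespace Cubic
open MvPolynomial (C X IsHomogeneous)

lemma isHomogeneous_quadratic (k : ℂ) (i j : Fin 4) :
    (C k * (X i * X j) : MvPolynomial (Fin 4) ℂ).IsHomogeneous 2 := by
  simpa using (MvPolynomial.isHomogeneous_C (Fin 4) k).mul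
    ((MvPolynomial.isHomogeneous_X ℂ i).mul (MvPolynomial.isHomogeneous_X ℂ j))

lemma isHomogeneous_cubic (k : ℂ) (i j l : Fin 4) :
    (C k * (X i * X j * X l) : MvPolynomial (Fin 4) ℂ).IsHomogeneous 3 := by
  simpa using (MvPolynomial.isHomogeneous_C (Fin 4) k).mul
    (((MvPolynomial.isHomogeneous_X ℂ i).mul (MvPolynomial.isHomogeneous_X ℂ j)).mul
      (MvPolynomial.isHomogeneous_X ℂ l))

/-- The Hessian of the generic binary cubic. -/
def hessianPoly : (MvPolynomial (Fin 4) ℂ)[X] :=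
  Polynomial.C (C 1 * (X 2 * X 2) + C (-3) * (X 1 * X 3)) * Polynomial.X ^ 2
    + Polynomial.C (C 1 * (X 1 * X 2) + C (-9) * (X 0 * X 3)) * Polynomial.X ^ 1
    + Polynomial.C (C 1 * (X 1 * X 1) + C (-3) * (X 0 * X 2)) * Polynomial.X ^ 0

/-- The cubic covariant of the generic binary cubic. -/
def covariantPoly : (MvPolynomial (Fin 4) ℂ)[X] :=
  Polynomial.C (C 27 * (X 3 * X 3 * X 0) + C (-9) * (X 3 * X 2 * X 1) + C 2 * (X 2 * X 2 * X 2))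
      * Polynomial.X ^ 3
    + Polynomial.C (C (-18) * (X 3 * X 1 * X 1) + C 27 * (X 3 * X 2 * X 0)
      + C 3 * (X 2 * X 2 * X 1)) * Polynomial.X ^ 2
    + Polynomial.C (C (-3) * (X 2 * X 1 * X 1) + C 18 * (X 2 * X 2 * X 0)
      + C (-27) * (X 3 * X 1 * X 0)) * Polynomial.X ^ 1
    + Polynomial.C (C (-2) * (X 1 * X 1 * X 1) + C 9 * (X 2 * X 1 * X 0)
      + C (-27) * (X 3 * X 0 * X 0)) * Polynomial.X ^ 0

/-- The form vanishing at the new points, in terms of the coefficients of the binary cubic. -/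
def newPoly (ε δ s : ℕ) : (MvPolynomial (Fin 4) ℂ)[X] :=
  hessianPoly ^ ε * (covariantPoly ^ δ * ∏ k ∈ Finset.range s,
    (Polynomial.C (C (1 - 4 * ((k + 7 : ℂ) / 27))) * hessianPoly ^ 3
      + Polynomial.C (C ((k + 7 : ℂ) / 27)) * covariantPoly ^ 2))

lemma homCoeff_hessianPoly : HomCoeff 2 hessianPoly :=
  (((HomCoeff.monomial ((isHomogeneous_quadratic _ _ _).add (isHomogeneous_quadratic _ _ _)) 2).add
    (.monomial ((isHomogeneous_quadratic _ _ _).add (isHomogeneous_quadratic _ _ _)) 1)).add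
    (.monomial ((isHomogeneous_quadratic _ _ _).add (isHomogeneous_quadratic _ _ _)) 0))

lemma homCoeff_covariantPoly : HomCoeff 3 covariantPoly := by
  have h : ∀ (k k' k'' : ℂ) (i j l i' j' l' i'' j'' l'' : Fin 4), IsHomogeneous
      (C k * (X i * X j * X l) + C k' * (X i' * X j' * X l') + C k'' * (X i'' * X j'' * X l'')) 3 :=
    fun _ _ _ _ _ _ _ _ _ _ _ _ => ((isHomogeneous_cubic _ _ _ _).add
      (isHomogeneous_cubic _ _ _ _)).add (isHomogeneous_cubic _ _ _ _)
  exact (((HomCoeff.monomial (h ..) 3).add (.monomial (h ..) 2)).add (.monomial (h ..) 1)).add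
    (.monomial (h ..) 0)

lemma homCoeff_newPoly (ε δ s : ℕ) : HomCoeff (ε * 2 + (δ * 3 + s * 6)) (newPoly ε δ s) := by
  refine (homCoeff_hessianPoly.pow ε).mul ((homCoeff_covariantPoly.pow δ).mul ?_)
  simpa using HomCoeff.prod (Finset.range s) fun k _ =>
    ((homCoeff_hessianPoly.pow 3).const_mul (1 - 4 * ((k + 7) / 27))).add
      ((homCoeff_covariantPoly.pow 2).const_mul ((k + 7) / 27))

section Coords

variable (z : PConf (Fin 3) CP1)

lemma coords_mk (j : Fin 4) : Conf.coords (Quotient.mk _ z) j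
    = ![(rep (z.1 0)).1 * (rep (z.1 1)).1 * (rep (z.1 2)).1,
      -((rep (z.1 0)).2 * (rep (z.1 1)).1 * (rep (z.1 2)).1
        + (rep (z.1 0)).1 * (rep (z.1 1)).2 * (rep (z.1 2)).1
        + (rep (z.1 0)).1 * (rep (z.1 1)).1 * (rep (z.1 2)).2),
      (rep (z.1 0)).1 * (rep (z.1 1)).2 * (rep (z.1 2)).2
        + (rep (z.1 0)).2 * (rep (z.1 1)).1 * (rep (z.1 2)).2
        + (rep (z.1 0)).2 * (rep (z.1 1)).2 * (rep (z.1 2)).1,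
      -((rep (z.1 0)).2 * (rep (z.1 1)).2 * (rep (z.1 2)).2)] j := by
  change (∏ i, pointForm (z.1 i)).coeff j = _
  simp only [Fin.prod_univ_three, pointForm_eq]
  generalize rep (z.1 0) = a
  generalize rep (z.1 1) = b
  generalize rep (z.1 2) = c
  have h : (Polynomial.C a.1 - Polynomial.C a.2 * Polynomial.X)
      * (Polynomial.C b.1 - Polynomial.C b.2 * Polynomial.X)
      * (Polynomial.C c.1 - Polynomial.C c.2 * Polynomial.X)
      = Polynomial.C (-(a.2 * b.2 * c.2)) * Polynomial.X ^ 3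
        + Polynomial.C (a.1 * b.2 * c.2 + a.2 * b.1 * c.2 + a.2 * b.2 * c.1) * Polynomial.X ^ 2
        + Polynomial.C (-(a.2 * b.1 * c.1 + a.1 * b.2 * c.1 + a.1 * b.1 * c.2))
          * Polynomial.X ^ 1 + Polynomial.C (a.1 * b.1 * c.1) * Polynomial.X ^ 0 := by
    simp only [map_neg, map_add, map_mul]; ring
  rw [h]
  simp only [Polynomial.coeff_add, Polynomial.coeff_C_mul_X_pow]
  fin_cases j <;> simp

/-- At α = [12][0v], β = -[01][2v], the invariants h and q are exactly the Hessian and the cubic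
covariant of the cubic with the given zeros. -/
lemma eval_newPoly (ε δ s : ℕ) (x : ℂ) :
    ((newPoly ε δ s).map (MvPolynomial.eval (Conf.coords (Quotient.mk _ z)))).eval x
      = newForm ε δ s (rep ∘ z.1) (x, 1) := by
  have hH : (hessianPoly.map (MvPolynomial.eval (Conf.coords (Quotient.mk _ z)))).eval x
      = hInv (br (rep (z.1 1)) (rep (z.1 2)) * br (rep (z.1 0)) (x, 1))
        (-(br (rep (z.1 0)) (rep (z.1 1)) * br (rep (z.1 2)) (x, 1))) := by
    simp only [hessianPoly, Polynomial.map_add, Polynomial.map_mul, Polynomial.map_pow,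
      Polynomial.map_C, Polynomial.map_X, Polynomial.eval_add, Polynomial.eval_mul,
      Polynomial.eval_pow, Polynomial.eval_C, Polynomial.eval_X, map_add, map_mul,
      MvPolynomial.eval_C, MvPolynomial.eval_X, coords_mk, hInv, br]
    simp
    ring
  have hQ : (covariantPoly.map (MvPolynomial.eval (Conf.coords (Quotient.mk _ z)))).eval x
      = qInv (br (rep (z.1 1)) (rep (z.1 2)) * br (rep (z.1 0)) (x, 1))
        (-(br (rep (z.1 0)) (rep (z.1 1)) * br (rep (z.1 2)) (x, 1))) := by
    simp only [covariantPoly, Polynomial.map_add, Polynomial.map_mul, Polynomial.map_pow,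
      Polynomial.map_C, Polynomial.map_X, Polynomial.eval_add, Polynomial.eval_mul,
      Polynomial.eval_pow, Polynomial.eval_C, Polynomial.eval_X, map_add, map_mul,
      MvPolynomial.eval_C, MvPolynomial.eval_X, coords_mk, qInv, br]
    simp
    ring
  simp only [newPoly, Polynomial.map_mul, Polynomial.map_pow, Polynomial.map_prod,
    Polynomial.map_add, Polynomial.map_C, Polynomial.eval_mul, Polynomial.eval_pow,
    Polynomial.eval_prod, Polynomial.eval_add, Polynomial.eval_C, MvPolynomial.eval_C, hH, hQ,
    ← orbitInv_eq]
  rfl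

end Coords

theorem exists_isSection {m : ℕ} (hm : m % 3 = 0 ∨ m % 3 = 2) :
    ∃ S : Conf 3 CP1 → BiConf 3 m CP1,
      IsSection S ∧ IsAlgebraicMap S ∧
      (∀ (g : GL (Fin 2) ℂ) (c : Conf 3 CP1), S (g • c) = g • S c) ∧
      ∃ L : Finset ℂ, 0 ∉ L ∧ 1 ∉ L ∧
        ∀ c : Conf 3 CP1, (newPoints (S c)).points = ⋃ l ∈ L, crossRatioOrbit c l := by
  obtain ⟨ε, δ, s, hε, hδ, rfl⟩ :
      ∃ ε δ s, ε ≤ 1 ∧ δ ≤ 1 ∧ m = ε * 2 + (δ * 3 + s * 6) := by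
    have : m % 6 = 0 ∨ m % 6 = 2 ∨ m % 6 = 3 ∨ m % 6 = 5 := by omega
    rcases this with h | h | h | h
    · exact ⟨0, 0, m / 6, by omega, by omega, by omega⟩
    · exact ⟨1, 0, m / 6, by omega, by omega, by omega⟩
    · exact ⟨0, 1, m / 6, by omega, by omega, by omega⟩
    · exact ⟨1, 1, m / 6, by omega, by omega, by omega⟩
  obtain ⟨S, hS, hZ⟩ := (isFormFamily hε hδ s).exists_section
  have hpts : ∀ c : Conf 3 CP1,
      (newPoints (S c)).points = ⋃ l ∈ crossRatios ε δ s, crossRatioOrbit c l := by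
    intro c
    induction c using Quotient.inductionOn with | h z =>
    obtain ⟨p, hp, h⟩ := hZ z
    ext q
    rw [mem_iUnion_crossRatioOrbit, h.eq_zero_iff (.rep q), hp]
    change q ∈ Set.range p.1 ↔ _
    simp
  refine ⟨S, hS, ⟨?_, ?_⟩, fun g c => ?_, crossRatios ε δ s, ?_, ?_, hpts⟩
  · simpa only [hS.2] using isRegularMap_id
  · exact isRegularMap_of_homCoeff hZ (homCoeff_newPoly ε δ s) fun z x => eval_newPoly z ε δ s x
  -- Equivariance can be checked on point sets, and the new ones are described by cross-ratios,
  -- which are invariant.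
  · refine BiConf.ext ?_ (Conf.ext_points ?_)
    · rw [oldPoints_smul, hS.2, hS.2]
    · rw [newPoints_smul, Conf.points_smul, hpts, hpts]
      simp only [smul_crossRatioOrbit, Set.image_iUnion]
  · rw [mem_crossRatios]
    exact anharmonic_ne_zero (by simp [hInv]) (by simp [eInv]) ε δ s
  · rw [mem_crossRatios]
    exact anharmonic_ne_zero (by simp [hInv]) (by simp [eInv]) ε δ s

end Cubic
end SphereConf
end

open SphereConf in
theorem theoremB :
    (∀ m : ℕ, (m % 3 = 0 ∨ m % 3 = 2) →
      ∃ S : Conf 3 CP1 → BiConf 3 m CP1,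
        IsSection S ∧ IsAlgebraicMap S ∧
        (∀ (g : GL (Fin 2) ℂ) (c : Conf 3 CP1), S (g • c) = g • S c) ∧
        ∃ L : Finset ℂ, 0 ∉ L ∧ 1 ∉ L ∧
          ∀ c : Conf 3 CP1, (newPoints (S c)).points = ⋃ l ∈ L, crossRatioOrbit c l) ∧
    (∀ m : ℕ, 70 ≤ m → (m % 24 = 0 ∨ m % 24 = 6 ∨ m % 24 = 16 ∨ m % 24 = 22) →
      ∃ S : Conf 4 CP1 → BiConf 4 m CP1, IsSection S) :=
  ⟨fun _ hm => Cubic.exists_isSection hm, fun _ _ hm => Quartic.exists_isSection hm⟩
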